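/- **Theorem 1.3.** Two metric spaces $(X,d_X)$, $(Y,d_Y)$ are *strictly Hölder equivalent* if there are a bijection $f:X\to Y$ and constants $s,C>0$ such that $C^{-1}d_X(x_1,x_2)^s\le d_Y(f(x_1),f(x_2))\le C\,d_X(x_1,x_2)^s$ for all $x_1,x_2\in X$. For $r_1,r_2\in(0,1)$ let $\mathcal S(r_1,r_2)$ be the collection of nonempty compact sets $K\subset\mathbb R^d$ (for some $d$) such that $K=\varphi_1(K)\cup\varphi_2(K)$ and $\varphi_1(K)\cap\varphi_2(K)=\emptyset$ for some similitudes $\varphi_1,\varphi_2$ of $\mathbb R^d$ with ratios $r_1,r_2$ respectively (the self-similar sets with ratios $r_1,r_2$ satisfying the strong separation condition). Let $r_1,r_2,t_1,t_2\in(0,1)$ with $r_1\ge r_2$ and $t_1\ge t_2$, and let $E\in\mathcal S(r_1,r_2)$ and $F\in\mathcal S(t_1,t_2)$; the ambient dimensions of $E$ and $F$ may differ. (i) If $\log r_1/\log r_2\notin\mathbb Q$, then $E$ and $F$ are strictly Hölder equivalent if and only if $$\frac{\log r_1}{\log t_1}=\frac{\log r_2}{\log t_2}.$$ (ii) If $\log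 r_1/\log r_2\in\mathbb Q$, then $E$ and $F$ are strictly Hölder equivalent if and only if one of the following holds: - $\dfrac{\log r_1}{\log t_1}=\dfrac{\log r_2}{\log t_2}$; - $\dfrac{\log r_1}{\log r_2}=\dfrac23$ and $\dfrac{\log t_1}{\log t_2}=\dfrac15$; - $\dfrac{\log r_1}{\log r_2}=\dfrac15$ and $\dfrac{\log t_1}{\log t_2}=\dfrac23$. -/

import Mathlib

/-- Strict Hölder equivalence of metric spaces: there are a bijection `f : X → Y` and constants
`s, C > 0` with `C⁻¹ d(x₁,x₂)^s ≤ d(f x₁, f x₂) ≤ C d(x₁,x₂)^s` for all `x₁, x₂`. -/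
def StrictHolderEquiv (X Y : Type*) [MetricSpace X] [MetricSpace Y] : Prop :=
  ∃ f : X → Y, Function.Bijective f ∧ ∃ s C : ℝ, 0 < s ∧ 0 < C ∧
    ∀ x₁ x₂ : X, C⁻¹ * dist x₁ x₂ ^ s ≤ dist (f x₁) (f x₂) ∧
      dist (f x₁) (f x₂) ≤ C * dist x₁ x₂ ^ s

/-- `φ` is a similitude with ratio `r`. -/
def IsSimilitude {X : Type*} [MetricSpace X] (r : ℝ) (φ : X → X) : Prop :=
  ∀ x y : X, dist (φ x) (φ y) = r * dist x y

/-- `K` is the attractor of the family `φ` (for contractions `φ j` of a complete space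
there is exactly one such set). -/
def IsAttractor {X : Type*} [MetricSpace X] {m : ℕ} (φ : Fin m → X → X) (K : Set X) : Prop :=
  K.Nonempty ∧ IsCompact K ∧ K = ⋃ j, φ j '' K

/-- The strong separation condition: the pieces `φ j '' K` are pairwise disjoint. -/
def StrongSeparation {X : Type*} {m : ℕ} (φ : Fin m → X → X) (K : Set X) : Prop :=
  ∀ i j : Fin m, i ≠ j → Disjoint (φ i '' K) (φ j '' K)

/-- The class `𝒮(r₁, …, r_m)` in `ℝ^d`: self-similar sets with contraction ratios
`r₁, …, r_m` satisfying the strong separation condition. It is meant for `r j ∈ (0, 1)`. -/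
def SelfSimilarSSC (d : ℕ) {m : ℕ} (r : Fin m → ℝ) : Set (Set (EuclideanSpace ℝ (Fin d))) :=
  {K | ∃ φ : Fin m → EuclideanSpace ℝ (Fin d) → EuclideanSpace ℝ (Fin d),
    (∀ j, IsSimilitude (r j) (φ j)) ∧ IsAttractor φ K ∧ StrongSeparation φ K}

/-!
Strong separation makes a self-similar set with two pieces a copy of the shift space `ℕ → Fin 2`,
the distance of two sequences being comparable to the product of the ratios along their longest
common prefix (`exists_coding`). Hence proportional logarithms of the ratios give a strict Hölder
equivalence (`strictHolderEquiv_of_ratios`). The exceptional pair is equivalent because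
subdividing one piece of each set yields three pieces with logarithmic ratios `2 : 5 : 6` in both
cases (`exists_three_ratios`).

Conversely, after passing to powers `P` and `Q` of the ratios with `Q 0 + Q 1 = 1`, a strict Hölder
equivalence becomes a bi-Lipschitz bijection `f` of the shift. The image of a cylinder is a union of
boundedly many cylinders of comparable size, so up to a weight its Bernoulli measure takes
finitely many values. The density of this measure with respect to `P` is a `P`-average over the two
halves of a cylinder; boundedness then gives `P 0 + P 1 = 1`, and near its supremum the density
must be constant (`IsShiftBiLipschitz.exists_scaling`). Two consequences are used for `f` and for
its inverse: the weights `P` and `Q` generate the same field, and each weight of one pair has a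
power that is a product of powers of the other pair (`exists_log_relation`).

If `log (P 0) / log (P 1)` is irrational, the two matrices of exponents are monomial, so that
`P j = Q (π j) ^ α j` for a permutation `π` and rationals `α j`. The image of a sequence then
contains about `α j` times as many letters `π j` as the sequence contains letters `j`. But
continuity and injectivity of `f` give sequences with at most `l` letters `j`, up to a constant,
whose image has at least `l` letters `π j` (`exists_count_le_count`). So `α j ≥ 1`, and `P = Q` as
both pairs sum to one.

If the ratio is rational, all four weights are powers of one `z` in the field generated by either
pair, so `z` is a root of two trinomials `X ^ n + X ^ m - 1`. By Ljunggren's method such a trinomial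
is the minimal polynomial of `z` times a factor whose roots are roots of unity; comparing degrees,
this factor is `1` or `X ^ 2 - X + 1` (`trinomial_factor`). Two such trinomials differ only when
`X ^ 5 + X - 1 = (X ^ 3 + X ^ 2 - 1) * (X ^ 2 - X + 1)`, which is the exceptional pair.
-/

/-! ### Trinomials with a common root in the unit interval -/

section trinomials

open Polynomial

/-- Ljunggren's lemma: up to sign and reversal, a unit trinomial is determined by its product
with its mirror image. -/
theorem Polynomial.IsUnitTrinomial.eq_of_mul_mirror_eq {p q : ℤ[X]} (hp : p.IsUnitTrinomial)
    (hpq : p * p.mirror = q * q.mirror) :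
    q = p ∨ q = -p ∨ q = p.mirror ∨ q = -p.mirror := by
  have hq : IsUnitTrinomial q := (isUnitTrinomial_iff'' hpq).mp hp
  obtain ⟨k, m, n, hkm, hmn, u, v, w, hp⟩ := hp
  obtain ⟨k', m', n', hkm', hmn', x, y, z, hq⟩ := hq
  have hk : k = k' := by
    rw [← mul_right_inj' (show 2 ≠ 0 from two_ne_zero), ←
      trinomial_natTrailingDegree hkm hmn u.ne_zero, ← hp, ← natTrailingDegree_mul_mirror, hpq,
      natTrailingDegree_mul_mirror, hq, trinomial_natTrailingDegree hkm' hmn' x.ne_zero]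
  have hn : n = n' := by
    rw [← mul_right_inj' (show 2 ≠ 0 from two_ne_zero), ← trinomial_natDegree hkm hmn w.ne_zero, ←
      hp, ← natDegree_mul_mirror, hpq, natDegree_mul_mirror, hq,
      trinomial_natDegree hkm' hmn' z.ne_zero]
  subst hk
  subst hn
  rcases eq_or_eq_neg_of_sq_eq_sq (y : ℤ) (v : ℤ)
      ((Int.isUnit_sq y.isUnit).trans (Int.isUnit_sq v.isUnit).symm) with h1 | h1
  · rw [h1] at hq
    rcases IsUnitTrinomial.irreducible_aux3 hkm hmn hkm' hmn' u v w x z hp hq hpq with h2 | h2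
    · exact Or.inl h2
    · exact Or.inr (Or.inr (Or.inl h2))
  · rw [h1] at hq
    have hp' : -p = trinomial k m n ((-u : ℤˣ) : ℤ) ((-v : ℤˣ) : ℤ) ((-w : ℤˣ) : ℤ) := by
      rw [hp, trinomial_def, trinomial_def]
      simp only [Units.val_neg, C_neg]
      ring
    have hpq' : -p * (-p).mirror = q * q.mirror := by
      rw [mirror_neg, neg_mul_neg, hpq]
    rcases IsUnitTrinomial.irreducible_aux3 hkm hmn hkm' hmn' (-u) (-v) (-w) x z hp'
      (by simpa using hq) hpq' with h2 | h2
    · exact Or.inr (Or.inl h2)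
    · exact Or.inr (Or.inr (Or.inr (h2.trans p.mirror_neg)))

theorem trinomial_eq_X_pow_add {m n : ℕ} :
    (X ^ n + X ^ m - 1 : ℤ[X]) = trinomial 0 m n ((-1 : ℤˣ) : ℤ) ((1 : ℤˣ) : ℤ) ((1 : ℤˣ) : ℤ) := by
  simp [trinomial_def]; ring

theorem mirror_X_pow_add {m n : ℕ} (hm : 0 < m) (hmn : m < n) :
    (X ^ n + X ^ m - 1 : ℤ[X]).mirror = 1 + X ^ (n - m) - X ^ n := by
  rw [trinomial_eq_X_pow_add, trinomial_mirror hm hmn (by simp) (by simp)]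
  simp [trinomial_def]; ring

/-- If `A` is a factor with a root in the unit interval, the complementary factor `B` is
self-reciprocal up to sign: the trinomial `A * B` and `A * B.mirror` have the same product with
their mirror images, so Ljunggren's lemma applies. -/
theorem mirror_factor_eq {m n : ℕ} (hm : 0 < m) (hmn : m < n) {z : ℝ} (hz : z ∈ Set.Ioo (0 : ℝ) 1)
    {A B : ℤ[X]} (hA : aeval z A = 0) (hf : (X ^ n + X ^ m - 1 : ℤ[X]) = A * B) :
    B.mirror = B ∨ B.mirror = -B := by
  have hf0 : (X ^ n + X ^ m - 1 : ℤ[X]).IsUnitTrinomial :=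
    ⟨0, m, n, hm, hmn, -1, 1, 1, trinomial_eq_X_pow_add⟩
  have hAB : A * B ≠ 0 := hf ▸ hf0.ne_zero
  have hA0 := left_ne_zero_of_mul hAB
  have hB0 : B.mirror ≠ 0 := by simpa using right_ne_zero_of_mul hAB
  have hmir := congrArg mirror hf
  rw [mirror_mul_of_domain, mirror_X_pow_add hm hmn] at hmir
  -- the mirror image of the trinomial has no root in the unit interval
  have hno : ¬ aeval z A.mirror = 0 := by
    intro h
    have h1 := congrArg (aeval z) hmir
    simp only [map_mul, h, zero_mul, map_sub, map_add, map_pow, aeval_X, map_one] at h1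
    have h2 : z ^ n < 1 := pow_lt_one₀ hz.1.le hz.2 (by lia)
    have h3 : 0 < z ^ (n - m) := pow_pos hz.1 _
    linarith
  have hq : (A * B) * (A * B).mirror = (A * B.mirror) * (A * B.mirror).mirror := by
    simp only [mirror_mul_of_domain, mirror_mirror]; ring
  rcases (hf ▸ hf0).eq_of_mul_mirror_eq hq with h | h | h | h
  · exact Or.inl (mul_left_cancel₀ hA0 h)
  · exact Or.inr (mul_left_cancel₀ hA0 (by rw [h]; ring))
  · rw [mirror_mul_of_domain] at h
    exact absurd (mul_right_cancel₀ hB0 h ▸ hA) hno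
  · rw [mirror_mul_of_domain, ← neg_mul] at h
    have := mul_right_cancel₀ hB0 h
    rw [this, map_neg, neg_eq_zero] at hA
    exact absurd hA hno

/-- The case of coprime exponents in `common_root`. Here `u = s ^ m` satisfies `u + u⁻¹ = 1`. -/
theorem common_root_coprime {m n : ℕ} (hmn : m < n) (hc : Nat.Coprime m n) {s : ℂ}
    (h1 : s ^ n + s ^ m = 1) (h2 : s ^ (m + n) = 1) : s ^ 2 - s + 1 = 0 ∧ 5 ≤ n := by
  obtain ⟨u, hu⟩ : ∃ u, u = s ^ m := ⟨_, rfl⟩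
  have hv : s ^ n = 1 - u := by rw [hu]; linear_combination h1
  have hu2 : u ^ 2 - u + 1 = 0 := by
    rw [pow_add, hv, ← hu] at h2; linear_combination -h2
  have hu3 : u ^ 3 = -1 := by linear_combination (u + 1) * hu2
  have hv6 : (1 - u) ^ 6 = 1 := by
    have : (1 - u) = - u ^ 2 := by linear_combination hu2
    rw [this]; linear_combination (u ^ 9 - u ^ 6 + u ^ 3 - 1) * hu3
  have hs6 : s ^ 6 = 1 := by
    have := pow_gcd_eq_one (a := s ^ 6) (m := m) (n := n) |>.mpr
      ⟨by rw [← pow_mul, mul_comm, pow_mul, ← hu]; linear_combination (u ^ 3 - 1) * hu3,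
        by rw [← pow_mul, mul_comm, pow_mul, hv, hv6]⟩
    rwa [hc, pow_one] at this
  have hmod : ∀ k : ℕ, s ^ k = s ^ (k % 6) := by
    intro k
    conv_lhs => rw [← Nat.div_add_mod k 6, pow_add, pow_mul, hs6, one_pow, one_mul]
  have hum := hmod m
  rw [← hu] at hum
  have h6 : m % 6 < 6 := Nat.mod_lt _ (by norm_num)
  interval_cases hr : m % 6
  · exfalso
    rw [hum] at hu2; norm_num at hu2
  · rw [pow_one] at hum
    refine ⟨by rw [← hum]; exact hu2, ?_⟩
    by_contra hn5
    have : n = 2 ∨ n = 3 ∨ n = 4 := by lia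
    rw [← hum] at hv
    rcases this with rfl | rfl | rfl
    · have : u = 1 := by linear_combination (hv - hu2) / 2
      rw [this] at hu2; norm_num at hu2
    · have : u = 2 := by linear_combination hv - hu3
      rw [this] at hu2; norm_num at hu2
    · have : (0 : ℂ) = 1 := by linear_combination hv - u * hu3
      norm_num at this
  · exfalso
    have h : u ^ 3 = 1 := by rw [hum]; linear_combination hs6
    have : (2 : ℂ) = 0 := by linear_combination hu3 - h
    norm_num at this
  · exfalso
    have h : u ^ 2 = 1 := by rw [hum]; linear_combination hs6
    have : u = 2 := by linear_combination h - hu2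
    rw [this] at hu2; norm_num at hu2
  · exfalso
    have h : u ^ 3 = 1 := by rw [hum]; linear_combination (s ^ 6 + 1) * hs6
    have : (2 : ℂ) = 0 := by linear_combination hu3 - h
    norm_num at this
  · have hsu : s * u = 1 := by rw [hum]; linear_combination hs6
    exact ⟨by linear_combination s ^ 2 * hu2 + (s - s * u - 1) * hsu, by lia⟩

/-- A common root `w` of `X ^ n + X ^ m - 1` and its mirror image is simple, and
`w ^ m.gcd n` is a primitive sixth root of unity. -/
theorem common_root {m n : ℕ} (hm : 0 < m) (hmn : m < n) {w : ℂ}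
    (h1 : w ^ n + w ^ m = 1) (h2 : 1 + w ^ (n - m) = w ^ n) :
    (w ^ (m.gcd n)) ^ 2 - w ^ (m.gcd n) + 1 = 0 ∧ 5 * m.gcd n ≤ n ∧
      (n : ℂ) * w ^ (n - 1) + m * w ^ (m - 1) ≠ 0 := by
  have h3 : w ^ (m + n) = 1 := by
    have : w ^ n = w ^ (n - m) * w ^ m := by rw [← pow_add]; congr 1; lia
    rw [pow_add]
    linear_combination h1 - w ^ m * h2 - this
  have hgpos : 0 < m.gcd n := Nat.gcd_pos_of_pos_left _ hm
  obtain ⟨m0, n0, hc, hm0, hn0⟩ := Nat.exists_coprime m n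
  set g := m.gcd n with hgdef
  have hm0' : 0 < m0 := Nat.pos_of_ne_zero (by rintro rfl; lia)
  have hmn0 : m0 < n0 := by
    rw [hm0, hn0] at hmn; exact lt_of_mul_lt_mul_right hmn (Nat.zero_le _)
  have e1 : (w ^ g) ^ n0 = w ^ n := by rw [← pow_mul, mul_comm, ← hn0]
  have e2 : (w ^ g) ^ m0 = w ^ m := by rw [← pow_mul, mul_comm, ← hm0]
  obtain ⟨h4, h5⟩ := common_root_coprime hmn0 hc (s := w ^ g) (by rw [e1, e2, h1])
    (by rw [pow_add, e1, e2, ← pow_add, h3])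
  refine ⟨h4, by nlinarith, fun h6 => ?_⟩
  -- a multiple root would satisfy `n * w ^ n = - m * w ^ m`, but `w` lies on the unit circle
  have hw : ‖w‖ = 1 := by
    refine Complex.norm_eq_one_of_pow_eq_one h3 (by lia)
  have h7 : (n : ℂ) * w ^ (n - 1) = - (m * w ^ (m - 1)) := by linear_combination h6
  have h8 := congrArg norm h7
  simp only [norm_mul, norm_neg, norm_pow, hw, one_pow, mul_one, Complex.norm_natCast] at h8
  have : n = m := by exact_mod_cast h8
  lia

/-- The factor complementary to one with a root in the unit interval is trivial or consists of
simple roots `w` with `w ^ m.gcd n` a primitive sixth root of unity. -/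
theorem factor_natDegree_le {m n : ℕ} (hm : 0 < m) (hmn : m < n) {z : ℝ}
    (hz : z ∈ Set.Ioo (0 : ℝ) 1)
    {A B : ℤ[X]} (hA : aeval z A = 0) (hB : B.Monic) (hf : (X ^ n + X ^ m - 1 : ℤ[X]) = A * B) :
    B = 1 ∨ (5 * m.gcd n ≤ n ∧ B.natDegree ≤ 2 * m.gcd n ∧
      (m.gcd n = 1 → B = X ^ 2 - X + 1)) := by
  have hBmir : B ∣ 1 + X ^ (n - m) - X ^ n := by
    rw [← mirror_X_pow_add hm hmn, hf, mirror_mul_of_domain]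
    rcases mirror_factor_eq hm hmn hz hA hf with h | h
    · exact ⟨A.mirror, by rw [h, mul_comm]⟩
    · exact ⟨-A.mirror, by rw [h]; ring⟩
  have hBf : B ∣ X ^ n + X ^ m - 1 := ⟨A, by rw [hf, mul_comm]⟩
  have hroot : ∀ w : ℂ, aeval w B = 0 → (w ^ (m.gcd n)) ^ 2 - w ^ (m.gcd n) + 1 = 0 ∧
      5 * m.gcd n ≤ n ∧ (n : ℂ) * w ^ (n - 1) + m * w ^ (m - 1) ≠ 0 := by
    intro w hw
    have h1 := aeval_eq_zero_of_dvd_aeval_eq_zero hBf hw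
    have h2 := aeval_eq_zero_of_dvd_aeval_eq_zero hBmir hw
    simp only [map_sub, map_add, map_pow, aeval_X, map_one] at h1 h2
    exact common_root hm hmn (by linear_combination h1) (by linear_combination h2)
  have hgpos : 0 < m.gcd n := Nat.gcd_pos_of_pos_left _ hm
  have hdeg : (B.map (algebraMap ℤ ℂ)).natDegree = B.natDegree := hB.natDegree_map _
  have hf0 : (X ^ n + X ^ m - 1 : ℂ[X]) ≠ 0 := by
    intro h
    have := congrArg (eval 0) h
    simp [hm.ne', (hm.trans hmn).ne'] at this
  have hBfC : B.map (algebraMap ℤ ℂ) ∣ X ^ n + X ^ m - 1 := by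
    have := Polynomial.map_dvd (algebraMap ℤ ℂ) hBf
    simpa using this
  have hnodup : (B.map (algebraMap ℤ ℂ)).roots.Nodup := by
    rw [Multiset.nodup_iff_count_le_one]
    intro w
    by_cases hw : w ∈ (B.map (algebraMap ℤ ℂ)).roots
    · refine (Multiset.count_le_of_le w (roots.le_of_dvd hf0 hBfC)).trans ?_
      rw [count_roots]
      by_contra hlt
      rw [not_le, one_lt_rootMultiplicity_iff_isRoot hf0] at hlt
      have hw' : aeval w B = 0 := by
        have := isRoot_of_mem_roots hw
        rwa [IsRoot, eval_map_algebraMap] at this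
      apply (hroot w hw').2.2
      have := hlt.2
      simpa [IsRoot, derivative_X_pow] using this
    · rw [Multiset.count_eq_zero_of_notMem hw]; exact zero_le_one
  have hcard : (B.map (algebraMap ℤ ℂ)).roots.card = B.natDegree := by
    rw [← hdeg]; exact splits_iff_card_roots.mp (IsAlgClosed.splits _)
  by_cases hB1 : B.natDegree = 0
  · exact Or.inl (hB.natDegree_eq_zero.mp hB1)
  right
  obtain ⟨w, hw⟩ := Multiset.card_pos_iff_exists_mem.mp (by rw [hcard]; lia)
  have hmem : ∀ w ∈ (B.map (algebraMap ℤ ℂ)).roots, aeval w B = 0 := by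
    intro w hw
    have := isRoot_of_mem_roots hw
    rwa [IsRoot, eval_map_algebraMap] at this
  have hG : (X ^ (2 * m.gcd n) - X ^ (m.gcd n) + 1 : ℂ[X]).natDegree = 2 * m.gcd n := by
    compute_degree!
    all_goals lia
  have hG0 : (X ^ (2 * m.gcd n) - X ^ (m.gcd n) + 1 : ℂ[X]) ≠ 0 := by
    intro h; rw [h] at hG; simp at hG; lia
  have hle : B.natDegree ≤ 2 * m.gcd n := by
    rw [← hcard, ← hG]
    refine (Multiset.card_le_card ((Multiset.le_iff_subset hnodup).mpr fun v hv => ?_)).trans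
      (card_roots' _)
    rw [mem_roots hG0]
    have := (hroot v (hmem v hv)).1
    simp only [IsRoot, eval_add, eval_sub, eval_pow, eval_X, eval_one]
    rw [mul_comm 2, pow_mul]
    exact this
  refine ⟨(hroot w (hmem w hw)).2.1, hle, fun hg => ?_⟩
  have hw1 := (hroot w (hmem w hw)).1
  have hprim : IsPrimitiveRoot w 6 := by
    rw [← isRoot_cyclotomic_iff, cyclotomic_six]
    simpa [IsRoot, hg] using hw1
  have hdvd : (X ^ 2 - X + 1 : ℤ[X]) ∣ B := by
    rw [← cyclotomic_six, cyclotomic_eq_minpoly hprim (by norm_num)]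
    exact minpoly.isIntegrallyClosed_dvd (hprim.isIntegral (by norm_num)) (hmem w hw)
  have hmon : (X ^ 2 - X + 1 : ℤ[X]).Monic := by
    rw [← cyclotomic_six]; exact cyclotomic.monic 6 ℤ
  have h2 : (X ^ 2 - X + 1 : ℤ[X]).natDegree = 2 := by compute_degree!
  exact (eq_of_monic_of_dvd_of_natDegree_le hmon hB hdvd (by rw [h2]; lia))

theorem natDegree_X_pow_add {m n : ℕ} (hmn : m < n) :
    (X ^ n + X ^ m - 1 : ℤ[X]).natDegree = n := by
  compute_degree!
  all_goals grind

theorem monic_X_pow_add {m n : ℕ} (hmn : m < n) : (X ^ n + X ^ m - 1 : ℤ[X]).Monic := by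
  rw [Monic, leadingCoeff, natDegree_X_pow_add hmn]
  simp [coeff_X_pow, hmn.ne', coeff_one, (Nat.zero_le m).trans_lt hmn |>.ne']

theorem isIntegral_of_pow_add_pow {m n : ℕ} (hmn : m < n) {x : ℝ} (hx : x ^ m + x ^ n = 1) :
    IsIntegral ℤ x := by
  refine ⟨_, monic_X_pow_add hmn, ?_⟩
  rw [← aeval_def]
  simp only [map_sub, map_add, map_pow, aeval_X, map_one]
  linarith

open IntermediateField in
/-- If a root `z` of the trinomial in the unit interval lies in the field generated by its power
`z ^ m`, then comparing degrees forces `m` and `n` to be coprime. Hence the trinomial is the minimal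
polynomial of `z`, up to the sixth cyclotomic polynomial. -/
theorem trinomial_factor {m n : ℕ} (hm : 0 < m) (hmn : m < n) {z : ℝ}
    (hz : z ∈ Set.Ioo (0 : ℝ) 1) (h : z ^ m + z ^ n = 1) (hmem : z ∈ ℚ⟮z ^ m⟯) :
    (X ^ n + X ^ m - 1 : ℤ[X]) = minpoly ℤ z ∨
      (X ^ n + X ^ m - 1 : ℤ[X]) = minpoly ℤ z * (X ^ 2 - X + 1) := by
  have hzint := isIntegral_of_pow_add_pow hmn h
  obtain ⟨B, hB⟩ := minpoly.isIntegrallyClosed_dvd hzint (p := X ^ n + X ^ m - 1)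
    (by simp only [map_sub, map_add, map_pow, aeval_X, map_one]; linarith)
  have hAm := minpoly.monic hzint
  have hBm : B.Monic := hAm.of_mul_monic_left (hB ▸ monic_X_pow_add hmn)
  have hdegA : (minpoly ℤ z).natDegree + B.natDegree = n := by
    rw [← hAm.natDegree_mul hBm, ← hB, natDegree_X_pow_add hmn]
  obtain ⟨m0, n0, hc, hm0, hn0⟩ := Nat.exists_coprime m n
  have hgpos : 0 < m.gcd n := Nat.gcd_pos_of_pos_left _ hm
  set g := m.gcd n with hg
  have hm0' : 0 < m0 := Nat.pos_of_ne_zero (by rintro rfl; lia)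
  have hmn0 : m0 < n0 := by
    rw [hm0, hn0] at hmn; exact lt_of_mul_lt_mul_right hmn (Nat.zero_le _)
  -- the degree of `z` is bounded by the degree of `z ^ g`
  have hx : (z ^ g) ^ m0 + (z ^ g) ^ n0 = 1 := by
    rw [← pow_mul, ← pow_mul, mul_comm g, mul_comm g, ← hm0, ← hn0, h]
  have hxint := isIntegral_of_pow_add_pow hmn0 hx
  have hle : (minpoly ℤ z).natDegree ≤ n0 := by
    have h1 : (minpoly ℚ z).natDegree = (minpoly ℤ z).natDegree := by
      rw [minpoly.isIntegrallyClosed_eq_field_fractions' ℚ hzint, hAm.natDegree_map]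
    have h2 : z ∈ ℚ⟮z ^ g⟯ := by
      have hsub : ℚ⟮z ^ m⟯ ≤ ℚ⟮z ^ g⟯ := by
        rw [adjoin_simple_le_iff, hm0, mul_comm, pow_mul]
        exact pow_mem (mem_adjoin_simple_self ℚ _) _
      exact hsub hmem
    have hxQ : IsIntegral ℚ (z ^ g) := hxint.tower_top
    have : FiniteDimensional ℚ ℚ⟮z ^ g⟯ := adjoin.finiteDimensional hxQ
    have h3 := minpoly.natDegree_le (A := ℚ) (⟨z, h2⟩ : ℚ⟮z ^ g⟯)
    rw [adjoin.finrank hxQ, ← minpoly.algebraMap_eq (algebraMap ℚ⟮z ^ g⟯ ℝ).injective] at h3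
    change (minpoly ℚ z).natDegree ≤ _ at h3
    have h4 : (minpoly ℚ (z ^ g)).natDegree ≤ n0 := by
      rw [minpoly.isIntegrallyClosed_eq_field_fractions' ℚ hxint,
        (minpoly.monic hxint).natDegree_map, ← natDegree_X_pow_add hmn0]
      refine natDegree_le_of_dvd (minpoly.isIntegrallyClosed_dvd hxint ?_)
        (monic_X_pow_add hmn0).ne_zero
      simp only [map_sub, map_add, map_pow, aeval_X, map_one]; linarith
    rw [← h1]; exact h3.trans h4
  rcases factor_natDegree_le hm hmn hz (minpoly.aeval ℤ z) hBm hB with h1 | ⟨h1, h2, h3⟩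
  · left; rw [hB, h1, mul_one]
  · right
    have : g = 1 := by
      by_contra hne
      have : 2 ≤ g := by lia
      have h5 : 5 ≤ n0 := by exact le_of_mul_le_mul_right (h1.trans_eq hn0) hgpos
      have : g * n0 ≤ n0 + 2 * g := by rw [mul_comm, ← hn0]; lia
      nlinarith
    rw [← h3 this, ← hB]

/-- The product with the sixth cyclotomic polynomial has eight terms, which must cancel down to
three. -/
theorem trinomial_eq_cyclotomic_mul {m n m' n' : ℕ} (hm : 0 < m) (hmn : m < n) (hm' : 0 < m')
    (hmn' : m' < n')
    (h : (X ^ n' + X ^ m' - 1 : ℤ[X]) = (X ^ n + X ^ m - 1) * (X ^ 2 - X + 1)) :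
    m = 2 ∧ n = 3 ∧ m' = 1 ∧ n' = 5 := by
  have h1 : (X ^ n' + X ^ m' - 1 : ℤ[X]) = X ^ (n + 2) - X ^ (n + 1) + X ^ n + X ^ (m + 2)
    - X ^ (m + 1) + X ^ m - X ^ 2 + X ^ 1 - X ^ 0 := by rw [h]; ring
  have hc : ∀ k, _ := fun k => congrArg (fun p => coeff p k) h1
  simp only [coeff_add, coeff_sub, coeff_X_pow, coeff_one] at hc
  have e1 : n' = n + 2 := by
    have a := hc (n + 2)
    have b := hc n'
    clear hc h h1
    grind (splits := 30)
  have e2 : n = m + 1 := by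
    have a := hc (n + 1)
    clear hc h h1
    grind (splits := 30)
  have e3 : m = 2 := by
    have a := hc 2
    clear hc h h1
    grind (splits := 30)
  have a := hc 1
  subst e1 e2 e3
  simpa [eq_comm] using a

open IntermediateField in
/-- Two trinomial equations with a common solution `z` in the unit interval coincide or are those
of the factorization `X ^ 5 + X - 1 = (X ^ 3 + X ^ 2 - 1) * (X ^ 2 - X + 1)`. -/
theorem exponents_eq_or_exceptional {e₁ e₂ e₃ e₄ : ℕ} {z : ℝ} (hz : z ∈ Set.Ioo (0 : ℝ) 1)
    (h1 : 0 < e₁) (h2 : e₁ ≤ e₂) (h3 : 0 < e₃) (h4 : e₃ ≤ e₄)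
    (hp : z ^ e₁ + z ^ e₂ = 1) (hq : z ^ e₃ + z ^ e₄ = 1)
    (hzp : z ∈ ℚ⟮z ^ e₁⟯) (hzq : z ∈ ℚ⟮z ^ e₃⟯) :
    (e₁ = e₃ ∧ e₂ = e₄) ∨ (e₁ = 2 ∧ e₂ = 3 ∧ e₃ = 1 ∧ e₄ = 5) ∨
      (e₁ = 1 ∧ e₂ = 5 ∧ e₃ = 2 ∧ e₄ = 3) := by
  have hinj := pow_right_injective₀ hz.1 hz.2.ne
  -- if the two exponents of one equation agree then `z` is rational, so not an algebraic integer
  have key : ∀ {a b c : ℕ}, z ^ a + z ^ a = 1 → z ∈ ℚ⟮z ^ a⟯ → b < c → z ^ b + z ^ c = 1 →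
      False := by
    intro a b c ha hza hbc h
    have hbot : ℚ⟮z ^ a⟯ = ⊥ := by
      rw [adjoin_simple_eq_bot_iff]
      exact mem_bot.mpr ⟨1 / 2, by
        rw [eq_ratCast]; push_cast; linarith⟩
    rw [hbot] at hza
    obtain ⟨q, hq⟩ := mem_bot.mp hza
    have hint := isIntegral_of_pow_add_pow hbc h
    rw [← hq, isIntegral_algebraMap_iff (algebraMap ℚ ℝ).injective] at hint
    obtain ⟨k, hk⟩ := IsIntegrallyClosed.isIntegral_iff.mp hint
    rw [← hk] at hq
    have hk' : (k : ℝ) = z := by rw [← hq]; simp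
    have hk0 : (0 : ℝ) < k := hk' ▸ hz.1
    have hk1 : (k : ℝ) < 1 := hk' ▸ hz.2
    norm_cast at hk0 hk1
    lia
  rcases h2.eq_or_lt with rfl | h2 <;> rcases h4.eq_or_lt with rfl | h4
  · left
    have : e₁ = e₃ := hinj (by simp only; linarith)
    exact ⟨this, this⟩
  · exact (key hp hzp h4 hq).elim
  · exact (key hq hzq h2 hp).elim
  have heq : (X ^ e₂ + X ^ e₁ - 1 : ℤ[X]) = X ^ e₄ + X ^ e₃ - 1 → e₁ = e₃ ∧ e₂ = e₄ := by
    intro h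
    have h5 : e₂ = e₄ := by
      rw [← natDegree_X_pow_add h2, h, natDegree_X_pow_add h4]
    subst h5
    exact ⟨hinj (by simp only; linarith), rfl⟩
  have hne : (X ^ 2 - X + 1 : ℤ[X]) ≠ 0 := by
    rw [← cyclotomic_six]; exact cyclotomic_ne_zero 6 ℤ
  rcases trinomial_factor h1 h2 hz hp hzp with hA | hA <;>
    rcases trinomial_factor h3 h4 hz hq hzq with hB | hB
  · exact Or.inl (heq (hA.trans hB.symm))
  · rw [← hA] at hB
    have := trinomial_eq_cyclotomic_mul h1 h2 h3 h4 hB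
    tauto
  · rw [← hB] at hA
    have := trinomial_eq_cyclotomic_mul h3 h4 h1 h2 hA
    tauto
  · exact Or.inl (heq (hA.trans hB.symm))

end trinomials

/-! ### Coding of self-similar sets by sequences -/

section coding

open Finset

/-- The product of the weights `p` of the first `n` letters of the sequence `x`. -/
def weight {ι : Type*} (p : ι → ℝ) (x : ℕ → ι) (n : ℕ) : ℝ := ∏ i ∈ range n, p (x i)

section weight

variable {ι : Type*} {p : ι → ℝ} {x y : ℕ → ι} {m n : ℕ}

@[simp] theorem weight_zero : weight p x 0 = 1 := by simp [weight]

theorem weight_succ : weight p x (n + 1) = weight p x n * p (x n) := prod_range_succ _ _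

theorem weight_add : weight p x (m + n) = weight p x m * weight p (fun i => x (m + i)) n :=
  prod_range_add _ _ _

theorem weight_congr (h : ∀ i < n, x i = y i) : weight p x n = weight p y n :=
  prod_congr rfl fun i hi => by rw [h i (mem_range.mp hi)]

theorem weight_pos (hp : ∀ j, 0 < p j) : 0 < weight p x n := prod_pos fun _ _ => hp _

theorem weight_le_pow {ρ : ℝ} (hp : ∀ j, 0 < p j) (h : ∀ j, p j ≤ ρ) : weight p x n ≤ ρ ^ n := by
  calc weight p x n ≤ ∏ _i ∈ range n, ρ := prod_le_prod (fun _ _ => (hp _).le) fun _ _ => h _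
    _ = ρ ^ n := by simp

theorem weight_anti (hp : ∀ j, p j ∈ Set.Ioo (0 : ℝ) 1) (h : m ≤ n) :
    weight p x n ≤ weight p x m := by
  obtain ⟨k, rfl⟩ := Nat.exists_eq_add_of_le h
  rw [weight_add]
  exact mul_le_of_le_one_right (weight_pos fun j => (hp j).1).le
    (prod_le_one (fun _ _ => (hp _).1.le) fun _ _ => (hp _).2.le)

theorem weight_rpow {s : ℝ} (hp : ∀ j, 0 < p j) :
    weight (fun j => p j ^ s) x n = weight p x n ^ s :=
  Real.finsetProd_rpow _ _ (fun _ _ => (hp _).le) s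

theorem exists_weight_bounds [Finite ι] (hp : ∀ j, p j ∈ Set.Ioo (0 : ℝ) 1) :
    ∃ a b : ℝ, 0 < a ∧ a < 1 ∧ 0 < b ∧ b < 1 ∧ ∀ j, a ≤ p j ∧ p j ≤ b := by
  have : Nonempty (Set.Ioo (0 : ℝ) 1) := ⟨⟨1 / 2, by norm_num, by norm_num⟩⟩
  obtain ⟨a, ha⟩ := Finite.exists_ge fun j => (⟨p j, hp j⟩ : Set.Ioo (0 : ℝ) 1)
  obtain ⟨b, hb⟩ := Finite.exists_le fun j => (⟨p j, hp j⟩ : Set.Ioo (0 : ℝ) 1)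
  exact ⟨a, b, a.2.1, a.2.2, b.2.1, b.2.2, fun j => ⟨ha j, hb j⟩⟩

end weight

section coding

variable {X : Type*} [MetricSpace X] {m : ℕ}

/-- The cylinder of points of `K` whose coding starts with the first `n` letters of `x`. -/
def cylinderSet (φ : Fin m → X → X) (K : Set X) : ℕ → (ℕ → Fin m) → Set X
  | 0, _ => K
  | n + 1, x => φ (x 0) '' cylinderSet φ K n fun i => x (i + 1)

theorem IsSimilitude.continuous {r : ℝ} {φ : X → X} (hr : 0 < r) (h : IsSimilitude r φ) :
    Continuous φ :=
  (LipschitzWith.of_dist_le_mul (K := ⟨r, hr.le⟩) fun x y => (h x y).le).continuous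

theorem IsSimilitude.injective {r : ℝ} {φ : X → X} (hr : 0 < r) (h : IsSimilitude r φ) :
    Function.Injective φ := fun x y hxy => by
  have := h x y
  rw [hxy, dist_self, eq_comm, mul_eq_zero] at this
  exact dist_eq_zero.mp (this.resolve_left hr.ne')

/-- Every sequence of letters is the coding of a point of the attractor, by compactness. -/
theorem exists_mem_cylinderSet {φ : Fin m → X → X} {K : Set X} (hφ : ∀ j, Continuous (φ j))
    (hK : IsAttractor φ K) (x : ℕ → Fin m) : ∃ p, ∀ n, p ∈ cylinderSet φ K n x := by
  obtain ⟨hne, hcpt, hKeq⟩ := hK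
  have hsub : ∀ j, φ j '' K ⊆ K := fun j => by
    conv_rhs => rw [hKeq]
    exact Set.subset_iUnion (fun j => φ j '' K) j
  have hc : ∀ n (x : ℕ → Fin m), IsCompact (cylinderSet φ K n x) := by
    intro n
    induction n with
    | zero => exact fun _ => hcpt
    | succ n ih => exact fun x => (ih _).image (hφ _)
  have hn : ∀ n (x : ℕ → Fin m), (cylinderSet φ K n x).Nonempty := by
    intro n
    induction n with
    | zero => exact fun _ => hne
    | succ n ih => exact fun x => (ih _).image _
  have ha : ∀ n (x : ℕ → Fin m), cylinderSet φ K (n + 1) x ⊆ cylinderSet φ K n x := by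
    intro n
    induction n with
    | zero => exact fun x => hsub _
    | succ n ih => exact fun x => Set.image_mono (ih _)
  obtain ⟨p, hp⟩ := IsCompact.nonempty_iInter_of_sequence_nonempty_isCompact_isClosed
    (fun n => cylinderSet φ K n x) (fun n => ha n x) (fun n => hn n x) (hc 0 x)
    (fun n => (hc n x).isClosed)
  exact ⟨p, fun n => Set.mem_iInter.mp hp n⟩

theorem exists_separation {φ : Fin m → X → X} {K : Set X} (hφ : ∀ j, Continuous (φ j))
    (hK : IsCompact K) (hsep : StrongSeparation φ K) :
    ∃ δ : ℝ, 0 < δ ∧ ∀ i j, i ≠ j → ∀ p ∈ K, ∀ q ∈ K, δ ≤ dist (φ i p) (φ j q) := by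
  have h : ∀ ij : Fin m × Fin m, ∃ δ : Set.Ioi (0 : ℝ), ij.1 ≠ ij.2 → ∀ p ∈ K, ∀ q ∈ K,
      (δ : ℝ) ≤ dist (φ ij.1 p) (φ ij.2 q) := by
    rintro ⟨i, j⟩
    by_cases hij : i = j
    · exact ⟨⟨1, Set.mem_Ioi.mpr one_pos⟩, fun h => absurd hij h⟩
    obtain ⟨δ, hδ, h⟩ := Metric.exists_pos_forall_lt_edist (hK.image (hφ i))
      (hK.image (hφ j)).isClosed (hsep i j hij)
    refine ⟨⟨δ, NNReal.coe_pos.mpr hδ⟩, fun _ p hp q hq => ?_⟩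
    have := h _ (Set.mem_image_of_mem _ hp) _ (Set.mem_image_of_mem _ hq)
    rw [edist_nndist] at this
    exact (NNReal.coe_lt_coe.mpr (ENNReal.coe_lt_coe.mp this)).le
  choose δ hδ using h
  obtain ⟨d, hd⟩ := Finite.exists_ge δ
  exact ⟨d, d.2, fun i j hij p hp q hq =>
    (Subtype.coe_le_coe.mpr (hd (i, j))).trans (hδ (i, j) hij p hp q hq)⟩

/-- Under strong separation a self-similar set is the full shift: points of `K` correspond to
sequences of letters, and distances are comparable to the weight of the longest common prefix. -/
theorem exists_coding {φ : Fin m → X → X} {K : Set X} {r : Fin m → ℝ}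
    (hr : ∀ j, r j ∈ Set.Ioo (0 : ℝ) 1) (hφ : ∀ j, IsSimilitude (r j) (φ j))
    (hK : IsAttractor φ K) (hsep : StrongSeparation φ K) :
    ∃ e : K ≃ (ℕ → Fin m), ∃ C : ℝ, 0 < C ∧ ∀ p q : K, p ≠ q →
      C⁻¹ * weight r (e p) (PiNat.firstDiff (e p) (e q)) ≤ dist p q ∧
      dist p q ≤ C * weight r (e p) (PiNat.firstDiff (e p) (e q)) := by
  have hcont := fun j => (hφ j).continuous (hr j).1
  have hinj := fun j => (hφ j).injective (hr j).1
  obtain ⟨δ, hδ, hsepδ⟩ := exists_separation hcont hK.2.1 hsep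
  obtain ⟨D, hD⟩ := Metric.isBounded_iff.mp hK.2.1.isBounded
  -- the coding of `p` is read off along the orbit of `p` under the inverse branches `T`
  have hpar : ∀ p : K, ∃ j : Fin m, ∃ q : K, φ j q = p := by
    rintro ⟨p, hp⟩
    have hp' := hp
    rw [hK.2.2] at hp'
    obtain ⟨j, q, hq, hqp⟩ := Set.mem_iUnion.mp hp'
    exact ⟨j, ⟨q, hq⟩, hqp⟩
  choose letter T hT using hpar
  have hletter : ∀ j (p q : K), φ j q = p → letter p = j := by
    intro j p q h
    by_contra hne
    exact Set.disjoint_left.mp (hsep _ _ hne) ⟨T p, (T p).2, hT p⟩ ⟨q, q.2, h⟩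
  let code : K → ℕ → Fin m := fun p i => letter (T^[i] p)
  have hdist : ∀ n (p q : K), (∀ i < n, code p i = code q i) →
      dist p q = weight r (code p) n * dist (T^[n] p) (T^[n] q) := by
    intro n p q
    induction n with
    | zero => simp
    | succ n ih =>
      intro h
      have h1 := hφ (code p n) (T^[n + 1] p) (T^[n + 1] q)
      have h2 : φ (code p n) (T^[n + 1] q) = T^[n] q := by
        rw [h n n.lt_succ_self, Function.iterate_succ_apply', hT]
      rw [h2, Function.iterate_succ_apply', hT] at h1
      rw [ih fun i hi => h i (hi.trans n.lt_succ_self), Subtype.dist_eq, h1, weight_succ,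
        ← Function.iterate_succ_apply' T n p, ← Subtype.dist_eq, mul_assoc]
  have hne : ∀ p q : K, p ≠ q → code p ≠ code q := by
    intro p q hpq heq
    obtain ⟨_, b, _, _, hb0, hb1, hb⟩ := exists_weight_bounds hr
    have hle : ∀ n, dist p q ≤ b ^ n * D := by
      intro n
      rw [hdist n p q fun i _ => congrFun heq i]
      exact mul_le_mul (weight_le_pow (fun j => (hr j).1) fun j => (hb j).2)
        (hD (T^[n] p).2 (T^[n] q).2) dist_nonneg (pow_nonneg hb0.le n)
    have hlim : Filter.Tendsto (fun n : ℕ => b ^ n * D) Filter.atTop (nhds (0 * D)) :=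
      (tendsto_pow_atTop_nhds_zero_of_lt_one hb0.le hb1).mul_const D
    rw [zero_mul] at hlim
    exact hpq (dist_le_zero.mp (ge_of_tendsto' hlim hle))
  have hcinj : Function.Injective code := fun p q h => not_imp_not.mp (hne p q) h
  have hsurj : Function.Surjective code := by
    intro x
    obtain ⟨p, hp⟩ := exists_mem_cylinderSet hcont hK x
    have key : ∀ i (x : ℕ → Fin m) (p : K), (∀ n, (p : X) ∈ cylinderSet φ K n x) →
        code p i = x i := by
      intro i
      have hstep : ∀ (x : ℕ → Fin m) (p : K), (∀ n, (p : X) ∈ cylinderSet φ K n x) →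
          letter p = x 0 ∧ ∀ n, (T p : X) ∈ cylinderSet φ K n fun i => x (i + 1) := by
        intro x p hp
        obtain ⟨q, hq, hqp⟩ := hp 1
        have h0 := hletter (x 0) p ⟨q, hq⟩ hqp
        refine ⟨h0, fun n => ?_⟩
        obtain ⟨q', hq', hqp'⟩ := hp (n + 1)
        have : q' = T p := by
          apply hinj (x 0)
          rw [hqp', ← h0, hT]
        rwa [← this]
      induction i with
      | zero => exact fun x p hp => (hstep x p hp).1
      | succ i ih => exact fun x p hp => ih _ (T p) (hstep x p hp).2
    exact ⟨⟨p, hp 0⟩, funext fun i => key i x ⟨p, hp 0⟩ hp⟩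
  refine ⟨Equiv.ofBijective code ⟨hcinj, hsurj⟩,
    max δ⁻¹ D, lt_max_of_lt_left (inv_pos.mpr hδ), fun p q hpq => ?_⟩
  change _ * weight r (code p) (PiNat.firstDiff (code p) (code q)) ≤ _ ∧
    _ ≤ _ * weight r (code p) (PiNat.firstDiff (code p) (code q))
  set n := PiNat.firstDiff (code p) (code q) with hn
  have hw : 0 < weight r (code p) n := weight_pos fun j => (hr j).1
  rw [hdist n p q fun i hi => PiNat.apply_eq_of_lt_firstDiff hi]
  constructor
  · rw [mul_comm]
    refine mul_le_mul_of_nonneg_left ?_ hw.le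
    calc (max δ⁻¹ D)⁻¹ ≤ δ⁻¹⁻¹ := inv_anti₀ (inv_pos.mpr hδ) (le_max_left _ _)
      _ = δ := inv_inv δ
      _ ≤ dist (T^[n] p) (T^[n] q) := by
        have h := hsepδ (code p n) (code q n) (PiNat.apply_firstDiff_ne (hne p q hpq))
          (T^[n + 1] p) (T^[n + 1] p).2 (T^[n + 1] q) (T^[n + 1] q).2
        rwa [Function.iterate_succ_apply', Function.iterate_succ_apply', hT, hT] at h
  · rw [mul_comm]
    exact mul_le_mul_of_nonneg_right
      ((hD (T^[n] p).2 (T^[n] q).2).trans (le_max_right _ _)) hw.le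

end coding

/-- If the ratios of one set are a fixed power of the ratios of the other one, the codings identify
the two sets, with the same power relating the distances. -/
theorem strictHolderEquiv_of_ratios {d d' m : ℕ} {r t : Fin m → ℝ} {σ : ℝ} (hσ : 0 < σ)
    (hr : ∀ j, r j ∈ Set.Ioo (0 : ℝ) 1) (ht : ∀ j, t j ∈ Set.Ioo (0 : ℝ) 1)
    (hrt : ∀ j, t j = r j ^ σ)
    {E : Set (EuclideanSpace ℝ (Fin d))} {F : Set (EuclideanSpace ℝ (Fin d'))}
    (hE : E ∈ SelfSimilarSSC d r) (hF : F ∈ SelfSimilarSSC d' t) : StrictHolderEquiv E F := by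
  obtain ⟨φ, hφ, hφK, hφs⟩ := hE
  obtain ⟨ψ, hψ, hψK, hψs⟩ := hF
  obtain ⟨e, C, hC, he⟩ := exists_coding hr hφ hφK hφs
  obtain ⟨e', C', hC', he'⟩ := exists_coding ht hψ hψK hψs
  refine ⟨e.trans e'.symm, (e.trans e'.symm).bijective, σ, C' * C ^ σ, hσ, by positivity,
    fun x y => ?_⟩
  by_cases hxy : x = y
  · simp [hxy, Real.zero_rpow hσ.ne']
  have h1 := he x y hxy
  have h2 := he' ((e.trans e'.symm) x) ((e.trans e'.symm) y) (by simpa using hxy)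
  simp only [Equiv.trans_apply, Equiv.apply_symm_apply] at h2 ⊢
  rw [show t = fun j => r j ^ σ from funext hrt, weight_rpow fun j => (hr j).1] at h2
  set w := weight r (e x) (PiNat.firstDiff (e x) (e y))
  have hw : 0 < w := weight_pos fun j => (hr j).1
  constructor
  · refine le_trans ?_ h2.1
    rw [mul_inv, mul_assoc]
    refine mul_le_mul_of_nonneg_left ?_ (by positivity)
    calc (C ^ σ)⁻¹ * dist x y ^ σ ≤ (C ^ σ)⁻¹ * (C * w) ^ σ := by gcongr; exact h1.2
      _ = w ^ σ := by rw [Real.mul_rpow hC.le hw.le]; field_simp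
  · refine h2.2.trans ?_
    rw [mul_assoc]
    refine mul_le_mul_of_nonneg_left ?_ hC'.le
    rw [← Real.mul_rpow hC.le dist_nonneg]
    gcongr
    rw [← inv_mul_le_iff₀ hC]
    exact h1.1

theorem SelfSimilarSSC.comp_equiv {d m : ℕ} {r : Fin m → ℝ} {K : Set (EuclideanSpace ℝ (Fin d))}
    (hK : K ∈ SelfSimilarSSC d r) (e : Fin m ≃ Fin m) : K ∈ SelfSimilarSSC d (r ∘ e) := by
  obtain ⟨φ, hφ, ⟨h1, h2, h3⟩, hs⟩ := hK
  refine ⟨φ ∘ e, fun j => hφ (e j), ⟨h1, h2, ?_⟩, fun i j hij => hs _ _ (e.injective.ne hij)⟩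
  conv_lhs => rw [h3]
  exact (e.surjective.iUnion_comp fun j => φ j '' K).symm

/-- A self-similar set with two pieces has three pieces if the second one is subdivided. -/
theorem SelfSimilarSSC.subdivide {d : ℕ} {a b : ℝ} (hb : 0 < b)
    {K : Set (EuclideanSpace ℝ (Fin d))} (hK : K ∈ SelfSimilarSSC d ![a, b]) :
    K ∈ SelfSimilarSSC d ![a, b * a, b * b] := by
  obtain ⟨φ, hφ, ⟨h1, h2, h3⟩, hs⟩ := hK
  have h0 : IsSimilitude a (φ 0) := hφ 0
  have h1' : IsSimilitude b (φ 1) := hφ 1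
  have hK2 : K = φ 0 '' K ∪ φ 1 '' K := by
    conv_lhs => rw [h3]
    ext; simp [Fin.exists_fin_two]
  have hdis : Disjoint (φ 0 '' K) (φ 1 '' K) := hs 0 1 (by decide)
  have hsub : ∀ j, φ j '' K ⊆ K := fun j => by
    conv_rhs => rw [h3]
    exact Set.subset_iUnion (fun j => φ j '' K) j
  have hd1 : Disjoint (φ 0 '' K) (φ 1 '' (φ 0 '' K)) := hdis.mono_right (Set.image_mono (hsub 0))
  have hd2 : Disjoint (φ 0 '' K) (φ 1 '' (φ 1 '' K)) := hdis.mono_right (Set.image_mono (hsub 1))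
  have hd3 : Disjoint (φ 1 '' (φ 0 '' K)) (φ 1 '' (φ 1 '' K)) :=
    (Set.disjoint_image_iff (h1'.injective hb)).mpr hdis
  refine ⟨![φ 0, φ 1 ∘ φ 0, φ 1 ∘ φ 1], ?_, ⟨h1, h2, ?_⟩, ?_⟩
  · intro j
    fin_cases j
    · exact h0
    · intro x y
      simp [h1' (φ 0 x) (φ 0 y), h0 x y, mul_assoc]
    · intro x y
      simp [h1' (φ 1 x) (φ 1 y), h1' x y, mul_assoc]
  · have : (⋃ j, ![φ 0, φ 1 ∘ φ 0, φ 1 ∘ φ 1] j '' K) =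
        φ 0 '' K ∪ (φ 1 '' (φ 0 '' K) ∪ φ 1 '' (φ 1 '' K)) := by
      ext; simp [Fin.exists_fin_succ]
    rw [this, ← Set.image_union, ← hK2, ← hK2]
  · intro i j hij
    fin_cases i <;> fin_cases j <;> simp [Set.image_comp] at hij ⊢ <;>
      first | assumption | (apply Disjoint.symm; assumption)

end coding

/-! ### Images of cylinders under bi-Lipschitz bijections of the shift -/

section cylinders

open Finset PiNat IntermediateField
open MeasureTheory hiding cylinder

/-- The bijection `f` of the full shift is bi-Lipschitz when sequences `x ≠ y` are at distance
`weight P x (firstDiff x y)` in the source and `weight Q x (firstDiff x y)` in the target. -/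
def IsShiftBiLipschitz (P Q : Fin 2 → ℝ) (f : (ℕ → Fin 2) ≃ (ℕ → Fin 2)) : Prop :=
  ∃ C : ℝ, 0 < C ∧ ∀ x y, x ≠ y →
    weight Q (f x) (firstDiff (f x) (f y)) ≤ C * weight P x (firstDiff x y) ∧
    weight P x (firstDiff x y) ≤ C * weight Q (f x) (firstDiff (f x) (f y))

section

variable {P Q : Fin 2 → ℝ} {f : (ℕ → Fin 2) ≃ (ℕ → Fin 2)}

theorem IsShiftBiLipschitz.symm (hf : IsShiftBiLipschitz P Q f) :
    IsShiftBiLipschitz Q P f.symm := by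
  obtain ⟨C, hC, h⟩ := hf
  refine ⟨C, hC, fun x y hxy => ?_⟩
  have := h (f.symm x) (f.symm y) (f.symm.injective.ne hxy)
  rw [f.apply_symm_apply, f.apply_symm_apply] at this
  exact ⟨this.2, this.1⟩

theorem tendsto_weight (hP : ∀ j, P j ∈ Set.Ioo (0 : ℝ) 1) (x : ℕ → Fin 2) :
    Filter.Tendsto (weight P x) Filter.atTop (nhds 0) := by
  obtain ⟨_, b, _, _, hb0, hb1, hb⟩ := exists_weight_bounds hP
  exact squeeze_zero (fun n => (weight_pos fun j => (hP j).1).le)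
    (fun n => weight_le_pow (fun j => (hP j).1) fun j => (hb j).2)
    (tendsto_pow_atTop_nhds_zero_of_lt_one hb0.le hb1)

theorem exists_weight_lt (hP : ∀ j, P j ∈ Set.Ioo (0 : ℝ) 1) (x : ℕ → Fin 2) {ε : ℝ} (hε : 0 < ε) :
    ∃ n, weight P x n < ε :=
  ((tendsto_weight hP x).eventually_lt_const hε).exists

theorem lt_of_weight_lt (hP : ∀ j, P j ∈ Set.Ioo (0 : ℝ) 1) {x : ℕ → Fin 2} {m n : ℕ}
    (h : weight P x m < weight P x n) : n < m := by
  by_contra hle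
  exact (weight_anti hP (not_lt.mp hle)).not_gt h

theorem weight_congr_cylinder {x y : ℕ → Fin 2} {m n : ℕ} (h : y ∈ cylinder x n) (hmn : m ≤ n) :
    weight P y m = weight P x m :=
  weight_congr fun i hi => h i (hi.trans_le hmn)

theorem IsShiftBiLipschitz.exists_image_subset (hP : ∀ j, P j ∈ Set.Ioo (0 : ℝ) 1)
    (hQ : ∀ j, Q j ∈ Set.Ioo (0 : ℝ) 1) (hf : IsShiftBiLipschitz P Q f) (x : ℕ → Fin 2) (N : ℕ) :
    ∃ n, ∀ y ∈ cylinder x n, f y ∈ cylinder (f x) N := by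
  obtain ⟨C, hC, h⟩ := hf
  obtain ⟨n, hn⟩ := exists_weight_lt hP x
    (ε := weight Q (f x) N / C) (div_pos (weight_pos fun j => (hQ j).1) hC)
  refine ⟨n, fun y hy => ?_⟩
  by_cases hxy : x = y
  · rw [hxy]; exact self_mem_cylinder _ _
  rw [lt_div_iff₀' hC] at hn
  rw [mem_cylinder_comm, mem_cylinder_iff_le_firstDiff hxy] at hy
  rw [mem_cylinder_comm, mem_cylinder_iff_le_firstDiff (f.injective.ne hxy)]
  refine (lt_of_weight_lt hQ (lt_of_le_of_lt ((h x y hxy).1.trans ?_) hn)).le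
  exact mul_le_mul_of_nonneg_left (weight_anti hP hy) hC.le

/-- The image of a cylinder lies in a cylinder of comparable weight and is a union of cylinders
that are longer by a bounded amount `L`; so are the images of its two halves. -/
theorem IsShiftBiLipschitz.image_cylinder (hP : ∀ j, P j ∈ Set.Ioo (0 : ℝ) 1)
    (hQ : ∀ j, Q j ∈ Set.Ioo (0 : ℝ) 1) (hf : IsShiftBiLipschitz P Q f) :
    ∃ (L : ℕ) (c C : ℝ), 0 < c ∧ 0 < C ∧ ∀ x n, ∃ N,
      c * weight P x n ≤ weight Q (f x) N ∧ weight Q (f x) N ≤ C * weight P x n ∧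
      (∀ y ∈ cylinder x n, f y ∈ cylinder (f x) N) ∧
      ∀ y ∈ cylinder x n, ∀ z ∈ cylinder (f y) (N + L), f.symm z ∈ cylinder y (n + 1) := by
  obtain ⟨C, hC, h⟩ := hf
  obtain ⟨a, b, ha0, _, hb0, hb1, hab⟩ := exists_weight_bounds hQ
  obtain ⟨L, hL⟩ := exists_pow_lt_of_lt_one (show 0 < 1 / (C * C) by positivity) hb1
  have hwP : ∀ x n, 0 < weight P x n := fun x n => weight_pos fun j => (hP j).1
  have hwQ : ∀ x n, 0 < weight Q x n := fun x n => weight_pos fun j => (hQ j).1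
  refine ⟨L, min 1 (C * a), C, lt_min one_pos (by positivity), hC, fun x n => ?_⟩
  have hex : ∃ N, weight Q (f x) N ≤ C * weight P x n :=
    (exists_weight_lt hQ (f x) (mul_pos hC (hwP x n))).imp fun _ => le_of_lt
  classical
  -- the first length at which the weight of the image has become as small as required
  obtain ⟨N, hN, hmin⟩ : ∃ N, weight Q (f x) N ≤ C * weight P x n ∧
      ∀ M, weight Q (f x) M ≤ C * weight P x n → N ≤ M :=
    ⟨Nat.find hex, Nat.find_spec hex, fun M hM => Nat.find_min' hex hM⟩
  have hin : ∀ y ∈ cylinder x n, f y ∈ cylinder (f x) N := by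
    intro y hy
    by_cases hxy : x = y
    · rw [hxy]; exact self_mem_cylinder _ _
    rw [mem_cylinder_comm, mem_cylinder_iff_le_firstDiff hxy] at hy
    rw [mem_cylinder_comm, mem_cylinder_iff_le_firstDiff (f.injective.ne hxy)]
    exact hmin _ ((h x y hxy).1.trans (mul_le_mul_of_nonneg_left (weight_anti hP hy) hC.le))
  refine ⟨N, ?_, hN, hin, fun y hy z hz => ?_⟩
  · rcases N with _ | N
    · rw [weight_zero]
      calc _ ≤ 1 * weight P x n := mul_le_mul_of_nonneg_right (min_le_left _ _) (hwP x n).le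
        _ ≤ 1 := by rw [one_mul]; simpa using weight_anti (x := x) hP (Nat.zero_le n)
    · have hlt : C * weight P x n < weight Q (f x) N := by
        by_contra hle
        exact absurd (hmin N (not_lt.mp hle)) (by lia)
      calc _ ≤ (C * a) * weight P x n := mul_le_mul_of_nonneg_right (min_le_right _ _) (hwP x n).le
        _ = (C * weight P x n) * a := by ring
        _ ≤ weight Q (f x) N * Q (f x N) := mul_le_mul hlt.le (hab _).1 ha0.le (hwQ _ _).le
        _ = _ := weight_succ.symm
  · by_contra hnot
    obtain ⟨w, rfl⟩ := f.surjective z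
    rw [f.symm_apply_apply] at hnot
    have hyw : y ≠ w := fun e => hnot (e ▸ self_mem_cylinder _ _)
    rw [mem_cylinder_comm, mem_cylinder_iff_le_firstDiff hyw] at hnot
    rw [mem_cylinder_comm, mem_cylinder_iff_le_firstDiff (f.injective.ne hyw)] at hz
    have h1 := (h y w hyw).2
    have h2 : weight P x n ≤ weight P y (firstDiff y w) := by
      rw [← weight_congr_cylinder hy le_rfl]
      exact weight_anti hP (by lia)
    have h3 : weight Q (f y) (firstDiff (f y) (f w)) ≤ weight Q (f x) N * b ^ L := by
      refine (weight_anti hQ hz).trans ?_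
      rw [weight_add, weight_congr_cylinder (hin y hy) le_rfl]
      exact mul_le_mul_of_nonneg_left
        (weight_le_pow (fun j => (hQ j).1) fun j => (hab j).2) (hwQ _ _).le
    have h4 : weight P x n ≤ C * ((C * weight P x n) * b ^ L) :=
      (h2.trans h1).trans (mul_le_mul_of_nonneg_left
        (h3.trans (mul_le_mul_of_nonneg_right hN (by positivity))) hC.le)
    rw [lt_div_iff₀ (by positivity)] at hL
    nlinarith [hwP x n]

theorem exists_bernoulli_measure (hQ : ∀ j, 0 < Q j) (hsum : Q 0 + Q 1 = 1) :
    ∃ ν : Measure (ℕ → Fin 2), IsProbabilityMeasure ν ∧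
      ∀ x n, ν.real (cylinder x n) = weight Q x n := by
  let μ : Measure (Fin 2) := ∑ j, ENNReal.ofReal (Q j) • Measure.dirac j
  have hμj : ∀ j, μ {j} = ENNReal.ofReal (Q j) := by
    intro j
    fin_cases j <;> simp [μ, Fin.sum_univ_two]
  have hμ : IsProbabilityMeasure μ := ⟨by
    simp [μ, Fin.sum_univ_two, ← ENNReal.ofReal_add (hQ 0).le (hQ 1).le, hsum]⟩
  refine ⟨Measure.infinitePi fun _ => μ, inferInstance, fun x n => ?_⟩
  have : cylinder x n = Set.pi (range n : Set ℕ) fun i => {x i} := by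
    rw [cylinder_eq_pi]
  rw [this, measureReal_def, Measure.infinitePi_pi _ fun _ _ => measurableSet_singleton _]
  simp only [hμj, ENNReal.toReal_prod, weight]
  exact prod_congr rfl fun i _ => ENNReal.toReal_ofReal (hQ _).le

/-- The measures, relative to the weights `Q`, of the nonempty unions of cylinders of length `L`. -/
def blockSums (Q : Fin 2 → ℝ) (L : ℕ) : Set ℝ :=
  (fun S : Finset (Fin L → Fin 2) => ∑ u ∈ S, ∏ i, Q (u i)) '' {S | S.Nonempty}

theorem blockSums_finite (L : ℕ) : (blockSums Q L).Finite := (Set.toFinite _).image _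

theorem blockSums_pos (hQ : ∀ j, 0 < Q j) {L : ℕ} {a : ℝ} (ha : a ∈ blockSums Q L) : 0 < a := by
  obtain ⟨S, hS, rfl⟩ := ha
  exact sum_pos (fun u _ => prod_pos fun i _ => hQ _) hS

theorem blockSums_mem_adjoin (hsum : Q 0 + Q 1 = 1) {L : ℕ} {a : ℝ} (ha : a ∈ blockSums Q L) :
    a ∈ ℚ⟮Q 0⟯ := by
  obtain ⟨S, _, rfl⟩ := ha
  refine sum_mem fun u _ => prod_mem fun i _ => ?_
  have h0 : Q 0 ∈ ℚ⟮Q 0⟯ := mem_adjoin_simple_self ℚ _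
  have h1 : Q 1 ∈ ℚ⟮Q 0⟯ := by
    rw [show Q 1 = 1 - Q 0 by linarith]; exact sub_mem (one_mem _) h0
  generalize u i = j
  fin_cases j <;> assumption

/-- A union of cylinders of length `N + L` inside a cylinder of length `N` has one of finitely
many measures relative to that cylinder. -/
theorem measure_eq_weight_mul_blockSum {ν : Measure (ℕ → Fin 2)} [IsProbabilityMeasure ν]
    (hν : ∀ x n, ν.real (cylinder x n) = weight Q x n) {A : Set (ℕ → Fin 2)} (hA : A.Nonempty)
    {z : ℕ → Fin 2} {N L : ℕ} (hAz : A ⊆ cylinder z N) (hAL : ∀ w ∈ A, cylinder w (N + L) ⊆ A) :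
    ∃ a ∈ blockSums Q L, ν.real A = weight Q z N * a := by
  classical
  -- the word `u` placed after the first `N` letters of `z`; the letters beyond are irrelevant
  let ext : (Fin L → Fin 2) → ℕ → Fin 2 := fun u i =>
    if i < N then z i else if h : i - N < L then u ⟨i - N, h⟩ else z i
  have hext : ∀ w ∈ cylinder z N, w ∈ cylinder (ext fun i => w (N + i)) (N + L) := by
    intro w hw i hi
    by_cases h : i < N
    · simp only [ext, h, if_true]; exact hw i h
    · have : i - N < L := by lia
      simp only [ext, h, if_false, this, dif_pos]
      congr 1; lia
  have hinj : ∀ u v, ext u ∈ cylinder (ext v) (N + L) → u = v := by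
    intro u v huv
    ext i
    have := huv (N + i) (by lia)
    simp [ext] at this
    rw [this]
  have hmeas : ∀ u, MeasurableSet (cylinder (ext u) (N + L)) := fun u =>
    (isOpen_cylinder _ _ _).measurableSet
  let S : Finset (Fin L → Fin 2) := univ.filter fun u => ext u ∈ A
  have hAeq : A = ⋃ u ∈ S, cylinder (ext u) (N + L) := by
    ext w
    simp only [Set.mem_iUnion, exists_prop, S, mem_filter, mem_univ, true_and]
    constructor
    · intro hw
      have h := hext w (hAz hw)
      exact ⟨fun i => w (N + i), hAL w hw ((mem_cylinder_comm _ _ _).mp h), h⟩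
    · rintro ⟨u, hu, hw⟩
      exact hAL _ hu hw
  have hdisj : (S : Set (Fin L → Fin 2)).PairwiseDisjoint fun u => cylinder (ext u) (N + L) := by
    intro u _ v _ huv
    rw [Function.onFun, Set.disjoint_left]
    intro w hu hv
    rw [mem_cylinder_comm] at hu
    rw [mem_cylinder_iff_eq] at hv
    rw [hv] at hu
    exact huv (hinj u v hu)
  have hw : ∀ u, weight Q (ext u) (N + L) = weight Q z N * ∏ i, Q (u i) := by
    intro u
    rw [weight_add]
    congr 1
    · exact weight_congr fun i hi => by simp [ext, hi]
    · rw [weight, Finset.prod_range]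
      exact prod_congr rfl fun i _ => by simp [ext]
  refine ⟨∑ u ∈ S, ∏ i, Q (u i), ⟨S, ?_, rfl⟩, ?_⟩
  · obtain ⟨w, hwA⟩ := hA
    exact ⟨fun i => w (N + i), by
      simpa [S] using hAL w hwA ((mem_cylinder_comm _ _ _).mp (hext w (hAz hwA)))⟩
  · conv_lhs => rw [hAeq]
    rw [measureReal_biUnion_finset hdisj fun u _ => hmeas u, mul_sum]
    exact sum_congr rfl fun u _ => by rw [hν, hw]

end

end cylinders

/-! ### Densities of images of cylinders -/

section densities

open Finset PiNat IntermediateField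
open MeasureTheory hiding cylinder

section

variable {P Q : Fin 2 → ℝ} {f : (ℕ → Fin 2) ≃ (ℕ → Fin 2)}

/-- Up to a weight, the measures of the images of a cylinder and of its two halves take only
finitely many values; the weight can be taken to be the same for all three. -/
theorem IsShiftBiLipschitz.measure_image_cylinder (hP : ∀ j, P j ∈ Set.Ioo (0 : ℝ) 1)
    (hQ : ∀ j, Q j ∈ Set.Ioo (0 : ℝ) 1) (hf : IsShiftBiLipschitz P Q f)
    {ν : Measure (ℕ → Fin 2)} [IsProbabilityMeasure ν]
    (hν : ∀ x n, ν.real (cylinder x n) = weight Q x n) :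
    ∃ (L : ℕ) (c C : ℝ), 0 < c ∧ 0 < C ∧ ∀ x n, ∃ N,
      c * weight P x n ≤ weight Q (f x) N ∧ weight Q (f x) N ≤ C * weight P x n ∧
      (∃ a ∈ blockSums Q L, ν.real (f '' cylinder x n) = weight Q (f x) N * a) ∧
      ∀ y ∈ cylinder x n, ∃ a ∈ blockSums Q L,
        ν.real (f '' cylinder y (n + 1)) = weight Q (f x) N * a := by
  obtain ⟨L, c, C, hc, hC, h⟩ := hf.image_cylinder hP hQ
  refine ⟨L, c, C, hc, hC, fun x n => ?_⟩
  obtain ⟨N, h1, h2, h3, h4⟩ := h x n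
  refine ⟨N, h1, h2, ?_, fun y hy => ?_⟩
  · refine measure_eq_weight_mul_blockSum hν
      (Set.Nonempty.image f ⟨x, self_mem_cylinder _ _⟩) ?_ ?_
    · rintro _ ⟨y, hy, rfl⟩
      exact h3 y hy
    · rintro _ ⟨y, hy, rfl⟩ z hz
      refine ⟨f.symm z, ?_, f.apply_symm_apply z⟩
      rw [← mem_cylinder_iff_eq.mp hy]
      exact cylinder_anti _ n.le_succ (h4 y hy z hz)
  · have hsub : cylinder y (n + 1) ⊆ cylinder x n := by
      rw [← mem_cylinder_iff_eq.mp hy]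
      exact cylinder_anti _ n.le_succ
    refine measure_eq_weight_mul_blockSum hν
      (Set.Nonempty.image f ⟨y, self_mem_cylinder _ _⟩) ?_ ?_
    · rintro _ ⟨w, hw, rfl⟩
      exact h3 w (hsub hw)
    · rintro _ ⟨w, hw, rfl⟩ z hz
      refine ⟨f.symm z, ?_, f.apply_symm_apply z⟩
      rw [← mem_cylinder_iff_eq.mp hw]
      exact h4 w (hsub hw) z hz

/-- Writing `μ` for the weight `P`, the density `ν (f '' I) / μ I` of a cylinder `I` is the
`P`-average of the densities of its two halves. -/
theorem density_eq_average (hP : ∀ j, P j ∈ Set.Ioo (0 : ℝ) 1)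
    {ν : Measure (ℕ → Fin 2)} [IsProbabilityMeasure ν]
    (hmeas : ∀ x n, MeasurableSet (f '' cylinder x n)) (x : ℕ → Fin 2) (n : ℕ) :
    ν.real (f '' cylinder x n) / weight P x n =
      ∑ j, P j * (ν.real (f '' cylinder (Function.update x n j) (n + 1)) /
        weight P (Function.update x n j) (n + 1)) := by
  have hw : weight P x n ≠ 0 := (weight_pos fun j => (hP j).1).ne'
  have hwj : ∀ j, weight P (Function.update x n j) (n + 1) = weight P x n * P j := by
    intro j
    rw [weight_succ, Function.update_self, weight_congr_cylinder (update_mem_cylinder x n j) le_rfl]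
  have hν : ν.real (f '' cylinder x n) =
      ∑ j, ν.real (f '' cylinder (Function.update x n j) (n + 1)) := by
    rw [← iUnion_cylinder_update x n, Set.image_iUnion,
      measureReal_iUnion_fintype _ fun j => hmeas _ _]
    intro i j hij
    refine (Set.disjoint_image_iff f.injective).mpr (Set.disjoint_left.mpr fun w h1 h2 => hij ?_)
    have h1 := h1 n n.lt_succ_self
    have h2 := h2 n n.lt_succ_self
    simp only [Function.update_self] at h1 h2
    exact h1.symm.trans h2
  rw [hν, sum_div]
  refine sum_congr rfl fun j _ => ?_
  rw [hwj]
  have := (hP j).1.ne'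
  field_simp

/-- A bounded positive function on cylinders which is a `P`-weighted sum over the two halves
forces `P 0 + P 1 = 1`. -/
theorem sum_eq_one_of_average (hP : ∀ j, P j ∈ Set.Ioo (0 : ℝ) 1)
    {g : (ℕ → Fin 2) → ℕ → ℝ} {a b : ℝ} (ha : 0 < a) (hga : ∀ x n, a ≤ g x n)
    (hgb : ∀ x n, g x n ≤ b)
    (hg : ∀ x n, g x n = ∑ j, P j * g (Function.update x n j) (n + 1)) : P 0 + P 1 = 1 := by
  have hsup : BddAbove (Set.range fun p : (ℕ → Fin 2) × ℕ => g p.1 p.2) :=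
    ⟨b, by rintro _ ⟨p, rfl⟩; exact hgb _ _⟩
  have hinf : BddBelow (Set.range fun p : (ℕ → Fin 2) × ℕ => g p.1 p.2) :=
    ⟨a, by rintro _ ⟨p, rfl⟩; exact hga _ _⟩
  set M := ⨆ p : (ℕ → Fin 2) × ℕ, g p.1 p.2 with hM
  set m := ⨅ p : (ℕ → Fin 2) × ℕ, g p.1 p.2 with hm
  have hgM : ∀ x n, g x n ≤ M := fun x n => le_ciSup hsup (x, n)
  have hgm : ∀ x n, m ≤ g x n := fun x n => ciInf_le hinf (x, n)
  have hm0 : 0 < m := ha.trans_le (le_ciInf fun p => hga _ _)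
  have hM0 : 0 < M := ha.trans_le ((hga (fun _ => 0) 0).trans (hgM _ _))
  have h1 : M ≤ (P 0 + P 1) * M := by
    refine ciSup_le fun p => ?_
    rw [hg, Fin.sum_univ_two, add_mul]
    exact add_le_add (mul_le_mul_of_nonneg_left (hgM _ _) (hP 0).1.le)
      (mul_le_mul_of_nonneg_left (hgM _ _) (hP 1).1.le)
  have h2 : (P 0 + P 1) * m ≤ m := by
    refine le_ciInf fun p => ?_
    rw [hg, Fin.sum_univ_two, add_mul]
    exact add_le_add (mul_le_mul_of_nonneg_left (hgm _ _) (hP 0).1.le)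
      (mul_le_mul_of_nonneg_left (hgm _ _) (hP 1).1.le)
  exact le_antisymm (by nlinarith) (by nlinarith)

/-- A bounded positive function on cylinders which is the average of its values on the two
halves, with only finitely many ratios between consecutive values, is constant on all cylinders
inside some cylinder: near its supremum it cannot increase by a definite factor. -/
theorem exists_constant_of_average (hP : ∀ j, P j ∈ Set.Ioo (0 : ℝ) 1) (hsum : P 0 + P 1 = 1)
    {g : (ℕ → Fin 2) → ℕ → ℝ} {b : ℝ} (hg0 : ∀ x n, 0 < g x n) (hgb : ∀ x n, g x n ≤ b)
    (hcyl : ∀ x y n, y ∈ cylinder x n → g y n = g x n)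
    (hg : ∀ x n, g x n = ∑ j, P j * g (Function.update x n j) (n + 1))
    {R : Set ℝ} (hR : R.Finite)
    (hgR : ∀ x n j, g (Function.update x n j) (n + 1) / g x n ∈ R) :
    ∃ x₀ n₀, ∀ y ∈ cylinder x₀ n₀, ∀ k, g y (n₀ + k) = g x₀ n₀ := by
  have hsup : BddAbove (Set.range fun p : (ℕ → Fin 2) × ℕ => g p.1 p.2) :=
    ⟨b, by rintro _ ⟨p, rfl⟩; exact hgb _ _⟩
  set M := ⨆ p : (ℕ → Fin 2) × ℕ, g p.1 p.2 with hM
  have hgM : ∀ x n, g x n ≤ M := fun x n => le_ciSup hsup (x, n)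
  have hM0 : 0 < M := (hg0 (fun _ => 0) 0).trans_le (hgM _ _)
  obtain ⟨ε, hε1, hε⟩ : ∃ ε : ℝ, 1 < ε ∧ ∀ ρ ∈ R, 1 < ρ → ε ≤ ρ := by
    have : Finite ↥(R ∩ Set.Ioi 1) := (hR.inter_of_left _).to_subtype
    have : Nonempty (Set.Ioi (1 : ℝ)) := ⟨⟨2, by norm_num⟩⟩
    obtain ⟨ε, hε⟩ := Finite.exists_ge fun ρ : ↥(R ∩ Set.Ioi 1) => (⟨ρ, ρ.2.2⟩ : Set.Ioi (1 : ℝ))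
    exact ⟨ε, ε.2, fun ρ h1 h2 => Subtype.coe_le_coe.mpr (hε ⟨ρ, h1, h2⟩)⟩
  have hstep : ∀ x n, M < g x n * ε → ∀ j, g (Function.update x n j) (n + 1) = g x n := by
    intro x n hx
    have hle : ∀ j, g (Function.update x n j) (n + 1) ≤ g x n := by
      intro j
      by_contra hlt
      have h1 := hε _ (hgR x n j) ((one_lt_div (hg0 x n)).mpr (not_le.mp hlt))
      rw [le_div_iff₀ (hg0 x n), mul_comm] at h1
      exact absurd (hx.trans_le h1) (not_lt.mpr (hgM _ _))
    have hav := hg x n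
    rw [Fin.sum_univ_two] at hav
    have h0 := (hP 0).1
    have h1 := (hP 1).1
    have e0 := hle 0
    have e1 := hle 1
    have hx1 : g x n = P 0 * g x n + P 1 * g x n := by rw [← add_mul, hsum, one_mul]
    have m0 := mul_le_mul_of_nonneg_left e0 h0.le
    have m1 := mul_le_mul_of_nonneg_left e1 h1.le
    refine Fin.forall_fin_two.mpr ⟨?_, ?_⟩
    · exact mul_left_cancel₀ h0.ne' (le_antisymm m0 (by linarith))
    · exact mul_left_cancel₀ h1.ne' (le_antisymm m1 (by linarith))
  obtain ⟨⟨x₀, n₀⟩, hx₀⟩ : ∃ p : (ℕ → Fin 2) × ℕ, M / ε < g p.1 p.2 :=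
    exists_lt_of_lt_ciSup (div_lt_self hM0 hε1)
  rw [div_lt_iff₀ (by linarith)] at hx₀
  refine ⟨x₀, n₀, fun y hy k => ?_⟩
  induction k with
  | zero => exact hcyl _ _ _ hy
  | succ k ih =>
    have := hstep y (n₀ + k) (by rw [ih]; exact hx₀) (y (n₀ + k))
    rw [Function.update_eq_self] at this
    rw [← add_assoc, this, ih]

/-- If the target weights sum to one then so do the source weights, and on some cylinder the
bijection multiplies the Bernoulli measure by a constant `c`. Hence `c` times a source weight is
a target weight up to a factor from a finite set, and the source weights lie in the field generated
by the target weights. -/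
theorem IsShiftBiLipschitz.exists_scaling (hP : ∀ j, P j ∈ Set.Ioo (0 : ℝ) 1)
    (hQ : ∀ j, Q j ∈ Set.Ioo (0 : ℝ) 1) (hsum : Q 0 + Q 1 = 1) (hf : IsShiftBiLipschitz P Q f) :
    P 0 + P 1 = 1 ∧ (∀ j, P j ∈ ℚ⟮Q 0⟯) ∧
    ∃ (x₀ : ℕ → Fin 2) (n₀ : ℕ) (c : ℝ) (V : Set ℝ), 0 < c ∧ V.Finite ∧ (∀ a ∈ V, 0 < a) ∧
      ∀ y ∈ cylinder x₀ n₀, ∀ k, ∃ N, ∃ a ∈ V, c * weight P y (n₀ + k) = weight Q (f y) N * a := by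
  obtain ⟨ν, hνp, hν⟩ := exists_bernoulli_measure (fun j => (hQ j).1) hsum
  obtain ⟨L, c, C, hc, hC, h⟩ := hf.measure_image_cylinder hP hQ hν
  have hwP : ∀ x n, 0 < weight P x n := fun x n => weight_pos fun j => (hP j).1
  have hwQ : ∀ x n, 0 < weight Q x n := fun x n => weight_pos fun j => (hQ j).1
  have hVpos : ∀ a ∈ blockSums Q L, 0 < a := fun a => blockSums_pos fun j => (hQ j).1
  have hVfin := blockSums_finite (Q := Q) L
  have hmeas : ∀ x n, MeasurableSet (f '' cylinder x n) := by
    intro x n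
    have hcont : Continuous f.symm := by
      rw [continuous_iff_continuousAt]
      intro z
      rw [ContinuousAt, (isTopologicalBasis_cylinders _).nhds_hasBasis.tendsto_right_iff]
      rintro _ ⟨⟨w, N, rfl⟩, hz⟩
      obtain ⟨n, hn⟩ := hf.symm.exists_image_subset hQ hP z N
      rw [← mem_cylinder_iff_eq.mp hz]
      exact Filter.mem_of_superset ((isOpen_cylinder _ z n).mem_nhds (self_mem_cylinder _ _)) hn
    rw [Equiv.image_eq_preimage_symm]
    exact ((isOpen_cylinder _ x n).preimage hcont).measurableSet
  let g : (ℕ → Fin 2) → ℕ → ℝ := fun x n => ν.real (f '' cylinder x n) / weight P x n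
  have hgeq : ∀ x n, g x n = ν.real (f '' cylinder x n) / weight P x n := fun _ _ => rfl
  have hg := density_eq_average hP (ν := ν) hmeas
  obtain ⟨A, hA⟩ := hVfin.bddAbove
  obtain ⟨B, hB0, hB⟩ : ∃ B : ℝ, 0 < B ∧ ∀ a ∈ blockSums Q L, B ≤ a := by
    have : Finite ↥(blockSums Q L) := hVfin.to_subtype
    obtain ⟨B, hB⟩ := Finite.exists_ge fun a : ↥(blockSums Q L) =>
      (⟨a, hVpos a a.2⟩ : Set.Ioi (0 : ℝ))
    exact ⟨B, B.2, fun a ha => Subtype.coe_le_coe.mpr (hB ⟨a, ha⟩)⟩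
  have hgA : ∀ x n, g x n ≤ C * A := by
    intro x n
    obtain ⟨N, _, h2, ⟨a, ha, h3⟩, -⟩ := h x n
    rw [hgeq, div_le_iff₀ (hwP _ _), h3]
    calc weight Q (f x) N * a ≤ (C * weight P x n) * A :=
          mul_le_mul h2 (hA ha) (hVpos a ha).le (mul_pos hC (hwP _ _)).le
      _ = _ := by ring
  have hgB : ∀ x n, c * B ≤ g x n := by
    intro x n
    obtain ⟨N, h1, -, ⟨a, ha, h3⟩, -⟩ := h x n
    rw [hgeq, le_div_iff₀ (hwP _ _), h3]
    calc c * B * weight P x n = (c * weight P x n) * B := by ring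
      _ ≤ weight Q (f x) N * a := mul_le_mul h1 (hB a ha) hB0.le (hwQ _ _).le
  have hg0 : ∀ x n, 0 < g x n := fun x n => (mul_pos hc hB0).trans_le (hgB x n)
  have hPsum := sum_eq_one_of_average hP (mul_pos hc hB0) hgB hgA hg
  have hRfin : ((fun t : (ℝ × ℝ) × Fin 2 => t.1.2 / (t.1.1 * P t.2)) ''
      ((blockSums Q L ×ˢ blockSums Q L) ×ˢ Set.univ)).Finite :=
    ((hVfin.prod hVfin).prod Set.finite_univ).image _
  obtain ⟨x₀, n₀, hconst⟩ := exists_constant_of_average hP hPsum hg0 hgA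
    (fun x y n hy => by
      rw [hgeq, hgeq, mem_cylinder_iff_eq.mp hy, weight_congr_cylinder hy le_rfl]) hg hRfin
    (fun x n j => by
      obtain ⟨N, -, -, ⟨a, ha, h3⟩, h4⟩ := h x n
      obtain ⟨a', ha', h5⟩ := h4 _ (update_mem_cylinder x n j)
      refine ⟨((a, a'), j), ⟨⟨ha, ha'⟩, Set.mem_univ _⟩, ?_⟩
      rw [hgeq, hgeq, h3, h5, weight_succ, Function.update_self,
        weight_congr_cylinder (update_mem_cylinder x n j) le_rfl]
      have := hwP x n
      have := hwQ (f x) N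
      have := hVpos a ha
      have := (hP j).1
      field_simp)
  have hscale : ∀ y ∈ cylinder x₀ n₀, ∀ k,
      g x₀ n₀ * weight P y (n₀ + k) = ν.real (f '' cylinder y (n₀ + k)) := by
    intro y hy k
    rw [← hconst y hy k, hgeq, div_mul_cancel₀ _ (hwP _ _).ne']
  refine ⟨hPsum, fun j => ?_, x₀, n₀, g x₀ n₀, blockSums Q L, hg0 _ _, hVfin, hVpos,
    fun y hy k => ?_⟩
  · obtain ⟨N, -, -, ⟨a, ha, h3⟩, h4⟩ := h x₀ n₀
    obtain ⟨a', ha', h5⟩ := h4 _ (update_mem_cylinder x₀ n₀ j)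
    have h7 := hscale x₀ (self_mem_cylinder _ _) 0
    rw [add_zero, h3] at h7
    rw [← hscale _ (update_mem_cylinder x₀ n₀ j) 1, weight_succ, Function.update_self,
      weight_congr_cylinder (update_mem_cylinder x₀ n₀ j) le_rfl] at h5
    have : P j = a' / a := by
      rw [eq_div_iff (hVpos a ha).ne']
      apply mul_left_cancel₀ (hwQ (f x₀) N).ne'
      linear_combination h5 - P j * h7
    rw [this]
    exact div_mem (blockSums_mem_adjoin hsum ha') (blockSums_mem_adjoin hsum ha)
  · obtain ⟨N, -, -, ⟨a, ha, h3⟩, -⟩ := h y (n₀ + k)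
    exact ⟨N, a, ha, by rw [hscale y hy k, h3]⟩

end

end densities

/-! ### Multiplicative relations between weights, and counting letters -/

section letters

open Finset PiNat IntermediateField

section

variable {P Q : Fin 2 → ℝ} {f : (ℕ → Fin 2) ≃ (ℕ → Fin 2)}

theorem log_weight (hQ : ∀ j, 0 < Q j) {i i' : Fin 2} (hi : i ≠ i') (z : ℕ → Fin 2) (N : ℕ) :
    Real.log (weight Q z N) = Nat.count (fun k => z k = i) N * Real.log (Q i) +
      Nat.count (fun k => z k = i') N * Real.log (Q i') := by
  induction N with
  | zero => simp
  | succ N ih =>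
    rw [weight_succ, Real.log_mul (weight_pos hQ).ne' (hQ _).ne', ih, Nat.count_succ,
      Nat.count_succ]
    have : z N = i ∨ z N = i' := by lia
    rcases this with h | h
    · simp only [h, hi, if_true, if_false]; push_cast; ring
    · simp only [h, hi.symm, if_true, if_false]; push_cast; ring

theorem count_eq_of_forall_not {p : ℕ → Prop} [DecidablePred p] {m n : ℕ} (h : ∀ k ≥ m, ¬ p k)
    (hmn : m ≤ n) : Nat.count p n = Nat.count p m := by
  induction n, hmn using Nat.le_induction with
  | base => rfl
  | succ n hn ih => rw [Nat.count_succ, if_neg (h n hn), ih, add_zero]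

theorem not_of_count_le {p : ℕ → Prop} [DecidablePred p] {l N : ℕ} (h : l ≤ Nat.count p N)
    (hle : ∀ M, Nat.count p M ≤ l) : ∀ M ≥ N, ¬ p M := by
  intro M hM hp
  have h1 := hle (M + 1)
  rw [Nat.count_succ, if_pos hp] at h1
  have h2 := Nat.count_monotone p hM
  lia

/-- Along the sequences that continue a fixed word by a single letter `j` forever, the finitely
many possible values recur, so a power of `P j` is a product of powers of the target weights. -/
theorem exists_log_relation (hP : ∀ j, P j ∈ Set.Ioo (0 : ℝ) 1)
    (hQ : ∀ j, Q j ∈ Set.Ioo (0 : ℝ) 1) {x₀ : ℕ → Fin 2} {n₀ : ℕ} {c : ℝ} {V : Set ℝ}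
    (hc : 0 < c) (hV : V.Finite) (hV0 : ∀ a ∈ V, 0 < a)
    (h : ∀ y ∈ cylinder x₀ n₀, ∀ k, ∃ N, ∃ a ∈ V,
      c * weight P y (n₀ + k) = weight Q (f y) N * a) (j : Fin 2) :
    ∃ k b₀ b₁ : ℕ, 0 < k ∧ k * Real.log (P j) = b₀ * Real.log (Q 0) + b₁ * Real.log (Q 1) := by
  have hwP : ∀ x n, 0 < weight P x n := fun x n => weight_pos fun j => (hP j).1
  have hwQ : ∀ x n, 0 < weight Q x n := fun x n => weight_pos fun j => (hQ j).1
  let y : ℕ → Fin 2 := fun i => if i < n₀ then x₀ i else j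
  have hy : y ∈ cylinder x₀ n₀ := fun i hi => by simp [y, hi]
  have hwy : ∀ k, weight P y (n₀ + k) = weight P y n₀ * P j ^ k := by
    intro k
    rw [weight_add]; simp [weight, y]
  choose N a haV hN using h y hy
  have : Finite V := hV.to_subtype
  obtain ⟨k₁, k₂, hne, heq⟩ : ∃ k₁ k₂, k₁ ≠ k₂ ∧ a k₁ = a k₂ := by
    obtain ⟨k₁, k₂, hne, heq⟩ :=
      Finite.exists_ne_map_eq_of_infinite fun k => (⟨a k, haV k⟩ : V)
    exact ⟨k₁, k₂, hne, congrArg Subtype.val heq⟩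
  wlog hlt : k₁ < k₂ generalizing k₁ k₂
  · exact this k₂ k₁ hne.symm heq.symm (lt_of_le_of_ne (not_lt.mp hlt) hne.symm)
  have h1 := hN k₁
  have h2 := hN k₂
  rw [hwy] at h1 h2
  rw [← heq] at h2
  have hNlt : N k₁ < N k₂ := by
    refine lt_of_weight_lt hQ (x := f y) (lt_of_mul_lt_mul_right ?_ (hV0 _ (haV k₁)).le)
    rw [← h1, ← h2]
    have := pow_lt_pow_right_of_lt_one₀ (hP j).1 (hP j).2 hlt
    have := hwP y n₀
    gcongr
  have hlog : ∀ k N : ℕ, c * (weight P y n₀ * P j ^ k) = weight Q (f y) N * a k₁ →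
      Real.log c + (Real.log (weight P y n₀) + k * Real.log (P j)) =
        (Nat.count (fun k => f y k = 0) N * Real.log (Q 0) +
          Nat.count (fun k => f y k = 1) N * Real.log (Q 1)) + Real.log (a k₁) := by
    intro k N h
    have h := congrArg Real.log h
    have hPk := pow_pos (hP j).1 k
    rwa [Real.log_mul hc.ne' (mul_pos (hwP _ _) hPk).ne', Real.log_mul (hwP _ _).ne' hPk.ne',
      Real.log_pow, Real.log_mul (hwQ _ _).ne' (hV0 _ (haV k₁)).ne',
      log_weight (fun j => (hQ j).1) (show (0 : Fin 2) ≠ 1 by decide)] at h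
  have e1 := hlog _ _ h1
  have e2 := hlog _ _ h2
  obtain ⟨d, hd⟩ := Nat.exists_eq_add_of_lt hlt
  obtain ⟨b₀, hb₀⟩ := Nat.exists_eq_add_of_le
    (Nat.count_monotone (fun k => f y k = 0) hNlt.le)
  obtain ⟨b₁, hb₁⟩ := Nat.exists_eq_add_of_le
    (Nat.count_monotone (fun k => f y k = 1) hNlt.le)
  refine ⟨d + 1, b₀, b₁, d.succ_pos, ?_⟩
  rw [hb₀, hb₁, hd] at e2
  push_cast at e2 ⊢
  linear_combination e2 - e1

/-- A continuous injection cannot map the sequences with at most `l` exceptional letters (beyond a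
fixed word) to sequences with fewer than `l` exceptional letters: changing one more letter, far
out, moves the image while keeping any given part of it, which must create a new exceptional
letter. -/
theorem exists_count_le_count (hf : ∀ x N, ∃ n, ∀ y ∈ cylinder x n, f y ∈ cylinder (f x) N)
    {j j' i : Fin 2} (hj : j ≠ j') (x₀ : ℕ → Fin 2) (n₀ l : ℕ) :
    ∃ y ∈ cylinder x₀ n₀, ∃ m ≥ n₀, (∀ k ≥ m, y k = j') ∧
      Nat.count (fun k => y k = j) m ≤ n₀ + l ∧ ∃ N, l ≤ Nat.count (fun k => f y k = i) N := by
  induction l with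
  | zero =>
    refine ⟨fun k => if k < n₀ then x₀ k else j', fun k hk => by simp [hk], n₀, le_rfl,
      fun k hk => by simp [hk], Nat.count_le _, 0, Nat.zero_le _⟩
  | succ l ih =>
    obtain ⟨y, hy, m, hm, hyj, hcount, N, hN⟩ := ih
    by_cases hmore : ∃ N, l + 1 ≤ Nat.count (fun k => f y k = i) N
    · exact ⟨y, hy, m, hm, hyj, by lia, hmore⟩
    obtain ⟨n, hn⟩ := hf y N
    let k := max m n
    have hmk : m ≤ k := le_max_left _ _
    let y' := Function.update y k j
    have hy'k : y' ∈ cylinder y k := update_mem_cylinder y k j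
    have hne : f y' ≠ f y := by
      refine f.injective.ne fun h => ?_
      have := congrFun h k
      rw [hyj k hmk] at this
      exact hj (by simpa [y'] using this)
    have hcyl := hn y' (cylinder_anti _ (le_max_right m n) hy'k)
    have hsame : Nat.count (fun t => f y' t = i) N = Nat.count (fun t => f y t = i) N := by
      rw [Nat.count_eq_card_filter_range, Nat.count_eq_card_filter_range]
      congr 1
      exact filter_congr fun t ht => by rw [hcyl t (mem_range.mp ht)]
    refine ⟨y', ?_, k + 1, by lia, fun t ht => ?_, ?_, ?_⟩
    · rw [← mem_cylinder_iff_eq.mp hy]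
      exact cylinder_anti _ (hm.trans hmk) hy'k
    · have : t ≠ k := by lia
      simp only [y', Function.update_of_ne this]
      exact hyj t (by lia)
    · have h1 : Nat.count (fun t => y' t = j) k = Nat.count (fun t => y t = j) k := by
        rw [Nat.count_eq_card_filter_range, Nat.count_eq_card_filter_range]
        congr 1
        exact filter_congr fun t ht => by rw [hy'k t (mem_range.mp ht)]
      have h2 := count_eq_of_forall_not (p := fun t => y t = j)
        (fun t ht => by rw [hyj t ht]; exact hj.symm) hmk
      rw [Nat.count_succ, h1, h2]
      split_ifs <;> lia
    · by_contra hless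
      push Not at hless hmore
      have a1 := not_of_count_le hN fun M => Nat.le_of_lt_succ (hmore M)
      have a2 := not_of_count_le (hsame ▸ hN) fun M => Nat.le_of_lt_succ (hless M)
      refine hne (funext fun t => ?_)
      rcases lt_or_ge t N with ht | ht
      · exact hcyl t ht
      · have := a1 t ht
        have := a2 t ht
        lia

/-- Suppose that the logarithms of the target weights are rationally independent and that
`P j ^ k = Q i ^ b`, with a similar relation between the other two letters. By the finiteness of
`V`, the number of letters `i` in the image of a sequence is `b / k` times its number of letters
`j`, up to a bounded error, so `exists_count_le_count` forces `k ≤ b`. -/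
theorem exponent_le (hP : ∀ j, P j ∈ Set.Ioo (0 : ℝ) 1)
    (hQ : ∀ j, Q j ∈ Set.Ioo (0 : ℝ) 1)
    (hf : ∀ x N, ∃ n, ∀ y ∈ cylinder x n, f y ∈ cylinder (f x) N)
    {x₀ : ℕ → Fin 2} {n₀ : ℕ} {c : ℝ} {V : Set ℝ}
    (hc : 0 < c) (hV : V.Finite) (hV0 : ∀ a ∈ V, 0 < a)
    (h : ∀ y ∈ cylinder x₀ n₀, ∀ k, ∃ N, ∃ a ∈ V,
      c * weight P y (n₀ + k) = weight Q (f y) N * a) {j j' i i' : Fin 2} (hj : j ≠ j')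
    (hi : i ≠ i') {k b k' b' : ℕ} (hk' : 0 < k')
    (hind : ∀ u v : ℤ, u * Real.log (Q i) + v * Real.log (Q i') = 0 → u = 0 ∧ v = 0)
    (h1 : k * Real.log (P j) = b * Real.log (Q i))
    (h2 : k' * Real.log (P j') = b' * Real.log (Q i')) : k ≤ b := by
  have hwP : ∀ x n, 0 < weight P x n := fun x n => weight_pos fun j => (hP j).1
  have hwQ : ∀ x n, 0 < weight Q x n := fun x n => weight_pos fun j => (hQ j).1
  obtain ⟨B, hB⟩ : ∃ B : ℤ, ∀ u v : ℤ, ∀ a ∈ V, u * Real.log (Q i) + v * Real.log (Q i') =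
      k * k' * (Real.log c - Real.log a) → u ≤ B := by
    have hinj : Function.Injective fun t : ℤ × ℤ =>
        (t.1 : ℝ) * Real.log (Q i) + t.2 * Real.log (Q i') := by
      rintro ⟨u, v⟩ ⟨u', v'⟩ huv
      have := hind (u - u') (v - v') (by push_cast; linear_combination huv)
      exact Prod.ext (by simp only; lia) (by simp only; lia)
    have hfin : (Prod.fst '' ((fun t : ℤ × ℤ =>
        (t.1 : ℝ) * Real.log (Q i) + t.2 * Real.log (Q i')) ⁻¹'
        ((fun a => k * k' * (Real.log c - Real.log a)) '' V))).Finite :=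
      ((hV.image _).preimage hinj.injOn).image _
    obtain ⟨B, hB⟩ := hfin.bddAbove
    exact ⟨B, fun u v a ha huv => hB ⟨(u, v), ⟨a, ha, huv.symm⟩, rfl⟩⟩
  obtain ⟨ε, hε0, hε⟩ : ∃ ε : ℝ, 0 < ε ∧ ∀ a ∈ V, ε ≤ a := by
    have : Finite V := hV.to_subtype
    obtain ⟨B, hB⟩ := Finite.exists_ge fun a : V => (⟨a, hV0 a a.2⟩ : Set.Ioi (0 : ℝ))
    exact ⟨B, B.2, fun a ha => Subtype.coe_le_coe.mpr (hB ⟨a, ha⟩)⟩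
  have key : ∀ l : ℕ, (k * k' * l : ℤ) ≤ k' * b * (n₀ + l) + B := by
    intro l
    obtain ⟨y, hy, m, hm, hyj, hcount, N₀, hN₀⟩ := exists_count_le_count hf (i := i) hj x₀ n₀ l
    obtain ⟨n, hn⟩ := exists_weight_lt hP y (ε := ε * weight Q (f y) N₀ / c)
      (div_pos (mul_pos hε0 (hwQ _ _)) hc)
    rw [lt_div_iff₀' hc] at hn
    obtain ⟨d, hd⟩ := Nat.exists_eq_add_of_le (hm.trans (le_max_left m n))
    obtain ⟨N, a, ha, hN⟩ := h y hy d
    rw [← hd] at hN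
    have hN₀N : N₀ ≤ N := by
      refine (lt_of_weight_lt hQ (x := f y) (lt_of_mul_lt_mul_right ?_ hε0.le)).le
      calc weight Q (f y) N * ε ≤ weight Q (f y) N * a :=
            mul_le_mul_of_nonneg_left (hε a ha) (hwQ _ _).le
        _ = c * weight P y (max m n) := hN.symm
        _ ≤ c * weight P y n := mul_le_mul_of_nonneg_left (weight_anti hP (le_max_right _ _)) hc.le
        _ < weight Q (f y) N₀ * ε := by rwa [mul_comm _ ε]
    have hlog := congrArg Real.log hN
    rw [Real.log_mul hc.ne' (hwP _ _).ne', Real.log_mul (hwQ _ _).ne' (hV0 a ha).ne',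
      log_weight (fun j => (hQ j).1) hi, log_weight (fun j => (hP j).1) hj] at hlog
    have hA := count_eq_of_forall_not (p := fun t => y t = j)
        (fun t ht => by rw [hyj t ht]; exact hj.symm) (le_max_left m n)
    rw [hA] at hlog
    set A := Nat.count (fun t => y t = j) m
    set A' := Nat.count (fun t => y t = j') (max m n)
    set Y := Nat.count (fun t => f y t = i) N with hY
    set Y' := Nat.count (fun t => f y t = i') N
    have hlY : l ≤ Y := hN₀.trans (Nat.count_monotone _ hN₀N)
    have := hB (k * k' * Y - k' * b * A) (k * k' * Y' - k * b' * A') a ha (by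
      push_cast
      linear_combination (-(k : ℝ) * k') * hlog + k' * A * h1 + k * A' * h2)
    have g1 : (k * k' * l : ℤ) ≤ k * k' * Y := by gcongr
    have g2 : (k' * b * A : ℤ) ≤ k' * b * (n₀ + l) := by
      gcongr; exact_mod_cast hcount
    lia
  by_contra hlt
  have hlt : b + 1 ≤ k := by lia
  have := key (k' * b * n₀ + B.natAbs + 1)
  have hBabs : B ≤ B.natAbs := Int.le_natAbs
  push_cast at this
  set X : ℤ := k' * b * n₀ + |B| + 1 with hX
  have hX0 : 0 ≤ X := by positivity
  have e1 : (k' * b + 1 : ℤ) ≤ k * k' := by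
    have : ((b + 1 : ℕ) : ℤ) * k' ≤ k * k' := by gcongr
    push_cast at this
    nlinarith
  have e2 := mul_le_mul_of_nonneg_right e1 hX0
  have := le_abs_self B
  nlinarith

end

end letters

/-! ### Rigidity of the weights -/

section rigidity

open Finset PiNat IntermediateField

section

variable {P Q : Fin 2 → ℝ} {f : (ℕ → Fin 2) ≃ (ℕ → Fin 2)}

theorem le_of_log_relation {p q : ℝ} (hp : 0 < p) (hq : q ∈ Set.Ioo (0 : ℝ) 1) {k b : ℕ}
    (hk : 0 < k) (hkb : k ≤ b) (h : k * Real.log p = b * Real.log q) : p ≤ q := by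
  rw [← Real.log_le_log_iff hp hq.1]
  have h1 : (k : ℝ) ≤ b := by exact_mod_cast hkb
  have h2 : (0 : ℝ) < k := by exact_mod_cast hk
  nlinarith [Real.log_neg hq.1 hq.2]

/-- With multiplicatively independent source weights, each source weight is matched with one
target weight, and counting letters shows that it is at most that weight. As both pairs sum to
one, they coincide. -/
theorem IsShiftBiLipschitz.eq_of_irrational (hP : ∀ j, P j ∈ Set.Ioo (0 : ℝ) 1)
    (hQ : ∀ j, Q j ∈ Set.Ioo (0 : ℝ) 1) (hPle : P 1 ≤ P 0) (hQle : Q 1 ≤ Q 0)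
    (hsum : Q 0 + Q 1 = 1) (hf : IsShiftBiLipschitz P Q f)
    (hirr : Irrational (Real.log (P 0) / Real.log (P 1))) : ∀ j, P j = Q j := by
  obtain ⟨hPsum, -, x₀, n₀, c, V, hc, hV, hV0, h⟩ := hf.exists_scaling hP hQ hsum
  obtain ⟨-, -, x₁, n₁, c', V', hc', hV', hV0', h'⟩ := hf.symm.exists_scaling hQ hP hPsum
  obtain ⟨k₁, b₁, c₁, hk₁, e₁⟩ := exists_log_relation hP hQ hc hV hV0 h 0
  obtain ⟨k₂, b₂, c₂, hk₂, e₂⟩ := exists_log_relation hP hQ hc hV hV0 h 1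
  obtain ⟨k₃, b₃, c₃, hk₃, e₃⟩ := exists_log_relation hQ hP hc' hV' hV0' h' 0
  obtain ⟨k₄, b₄, c₄, hk₄, e₄⟩ := exists_log_relation hQ hP hc' hV' hV0' h' 1
  have hp : ∀ j, Real.log (P j) < 0 := fun j => Real.log_neg (hP j).1 (hP j).2
  have hq : ∀ j, Real.log (Q j) < 0 := fun j => Real.log_neg (hQ j).1 (hQ j).2
  have hind : ∀ u v : ℤ, u * Real.log (P 0) + v * Real.log (P 1) = 0 → u = 0 ∧ v = 0 := by
    intro u v huv
    have hu : u = 0 := by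
      by_contra hu
      have hu' : (u : ℝ) ≠ 0 := by exact_mod_cast hu
      refine hirr ⟨-v / u, ?_⟩
      push_cast
      rw [div_eq_div_iff hu' (hp 1).ne]
      linear_combination -huv
    rw [hu, Int.cast_zero, zero_mul, zero_add, mul_eq_zero] at huv
    exact ⟨hu, by exact_mod_cast huv.resolve_right (hp 1).ne⟩
  -- the two nonnegative matrices expressing the logarithms in terms of each other are inverse up
  -- to scaling, so both are monomial
  have m₁ := (hind (b₁ * k₄ * b₃ + c₁ * k₃ * b₄ - k₁ * k₃ * k₄) (b₁ * k₄ * c₃ + c₁ * k₃ * c₄) (by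
    push_cast
    linear_combination (-(k₃ : ℝ) * k₄) * e₁ - b₁ * k₄ * e₃ - c₁ * k₃ * e₄)).2
  have m₂ := (hind (b₂ * k₄ * b₃ + c₂ * k₃ * b₄) (b₂ * k₄ * c₃ + c₂ * k₃ * c₄ - k₂ * k₃ * k₄) (by
    push_cast
    linear_combination (-(k₃ : ℝ) * k₄) * e₂ - b₂ * k₄ * e₃ - c₂ * k₃ * e₄)).1
  have n₁ : b₁ * k₄ * c₃ = 0 ∧ c₁ * k₃ * c₄ = 0 := by
    have : b₁ * k₄ * c₃ + c₁ * k₃ * c₄ = 0 := by exact_mod_cast m₁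
    exact Nat.add_eq_zero_iff.mp this
  have n₂ : b₂ * k₄ * b₃ = 0 ∧ c₂ * k₃ * b₄ = 0 := by
    have : b₂ * k₄ * b₃ + c₂ * k₃ * b₄ = 0 := by exact_mod_cast m₂
    exact Nat.add_eq_zero_iff.mp this
  have hnz : ∀ {k b c : ℕ} {x y z : ℝ}, 0 < k → z < 0 → k * z = b * x + c * y → b ≠ 0 ∨ c ≠ 0 := by
    intro k b c x y z hk hz h
    by_contra! h0
    rw [h0.1, h0.2] at h
    have : (0 : ℝ) < k := by exact_mod_cast hk
    have : k * z < 0 := mul_neg_of_pos_of_neg this hz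
    simp only [Nat.cast_zero, zero_mul, add_zero] at h
    exact this.ne h
  have z₁ := hnz hk₁ (hp 0) e₁
  have z₂ := hnz hk₂ (hp 1) e₂
  have z₃ := hnz hk₃ (hq 0) e₃
  have z₄ := hnz hk₄ (hq 1) e₄
  simp only [mul_eq_zero, hk₃.ne', hk₄.ne', or_false] at n₁ n₂
  have hcase : (c₁ = 0 ∧ b₂ = 0 ∧ b₁ ≠ 0 ∧ c₂ ≠ 0) ∨ (b₁ = 0 ∧ c₂ = 0 ∧ c₁ ≠ 0 ∧ b₂ ≠ 0) := by
    clear e₁ e₂ e₃ e₄ m₁ m₂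
    grind
  have himg := hf.exists_image_subset hP hQ
  rcases hcase with ⟨rfl, rfl, hb₁, hc₂⟩ | ⟨rfl, rfl, hc₁, hb₂⟩
  · have e₁ : k₁ * Real.log (P 0) = b₁ * Real.log (Q 0) := by simpa using e₁
    have e₂ : k₂ * Real.log (P 1) = c₂ * Real.log (Q 1) := by simpa using e₂
    have hind' : ∀ u v : ℤ, u * Real.log (Q 0) + v * Real.log (Q 1) = 0 → u = 0 ∧ v = 0 := by
      intro u v huv
      have := hind (u * c₂ * k₁) (v * b₁ * k₂) (by
        push_cast
        linear_combination (u * c₂ : ℝ) * e₁ + v * b₁ * e₂ + b₁ * c₂ * huv)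
      simpa [hb₁, hc₂, hk₁.ne', hk₂.ne'] using this
    have l₀ := le_of_log_relation (hP 0).1 (hQ 0) hk₁
      (exponent_le hP hQ himg hc hV hV0 h (j := 0) (j' := 1) (i := 0) (i' := 1) (by decide)
        (by decide) hk₂ hind' e₁ e₂) e₁
    have l₁ := le_of_log_relation (hP 1).1 (hQ 1) hk₂
      (exponent_le hP hQ himg hc hV hV0 h (j := 1) (j' := 0) (i := 1) (i' := 0) (by decide)
        (by decide) hk₁ (fun u v huv => (hind' v u (by linarith)).symm) e₂ e₁) e₂
    exact Fin.forall_fin_two.mpr ⟨by linarith, by linarith⟩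
  · have e₁ : k₁ * Real.log (P 0) = c₁ * Real.log (Q 1) := by simpa using e₁
    have e₂ : k₂ * Real.log (P 1) = b₂ * Real.log (Q 0) := by simpa using e₂
    have hind' : ∀ u v : ℤ, u * Real.log (Q 0) + v * Real.log (Q 1) = 0 → u = 0 ∧ v = 0 := by
      intro u v huv
      have := hind (v * b₂ * k₁) (u * c₁ * k₂) (by
        push_cast
        linear_combination (v * b₂ : ℝ) * e₁ + u * c₁ * e₂ + c₁ * b₂ * huv)
      simpa [hb₂, hc₁, hk₁.ne', hk₂.ne', and_comm] using this
    have l₀ := le_of_log_relation (hP 0).1 (hQ 1) hk₁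
      (exponent_le hP hQ himg hc hV hV0 h (j := 0) (j' := 1) (i := 1) (i' := 0) (by decide)
        (by decide) hk₂ (fun u v huv => (hind' v u (by linarith)).symm) e₁ e₂) e₁
    have l₁ := le_of_log_relation (hP 1).1 (hQ 0) hk₂
      (exponent_le hP hQ himg hc hV hV0 h (j := 1) (j' := 0) (i := 0) (i' := 1) (by decide)
        (by decide) hk₁ hind' e₂ e₁) e₂
    exact Fin.forall_fin_two.mpr ⟨by linarith, by linarith⟩

/-- Two numbers with commensurable logarithms are natural powers of a common `z`, which by
Bézout's identity lies in every field containing both. -/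
theorem exists_common_base {a b : ℝ} (ha : a ∈ Set.Ioo (0 : ℝ) 1) (hb : b ∈ Set.Ioo (0 : ℝ) 1)
    {q : ℚ} (h : Real.log a / Real.log b = q) :
    ∃ z ∈ Set.Ioo (0 : ℝ) 1, ∃ e e' : ℕ, 0 < e ∧ 0 < e' ∧ a = z ^ e ∧ b = z ^ e' ∧
      ∀ F : IntermediateField ℚ ℝ, a ∈ F → b ∈ F → z ∈ F := by
  have hla := Real.log_neg ha.1 ha.2
  have hlb := Real.log_neg hb.1 hb.2
  have hq0 : 0 < q := by
    have : (0 : ℝ) < q := h ▸ div_pos_of_neg_of_neg hla hlb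
    exact_mod_cast this
  have hnum := Rat.num_pos.mpr hq0
  obtain ⟨e, he⟩ := Int.eq_ofNat_of_zero_le hnum.le
  have hd := q.den_pos
  have hd' : (q.den : ℝ) ≠ 0 := by exact_mod_cast hd.ne'
  have hlog : q.den * Real.log a = e * Real.log b := by
    rw [div_eq_iff hlb.ne] at h
    have h2 : (q : ℝ) = e / q.den := by
      conv_lhs => rw [← Rat.num_div_den q, he]
      push_cast; rfl
    rw [h, h2]; field_simp
  have hcop : IsCoprime (e : ℤ) q.den := by
    rw [Nat.isCoprime_iff_coprime]
    have := q.reduced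
    rwa [he] at this
  obtain ⟨u, v, huv⟩ := hcop
  have huv' : (u * e + v * q.den : ℝ) = 1 := by exact_mod_cast huv
  have hz : 0 < a ^ u * b ^ v := mul_pos (zpow_pos ha.1 _) (zpow_pos hb.1 _)
  have hlz : Real.log (a ^ u * b ^ v) = u * Real.log a + v * Real.log b := by
    rw [Real.log_mul (zpow_pos ha.1 _).ne' (zpow_pos hb.1 _).ne', Real.log_zpow, Real.log_zpow]
  have hlz' : q.den * Real.log (a ^ u * b ^ v) = Real.log b := by
    rw [hlz]; linear_combination u * hlog + Real.log b * huv'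
  refine ⟨a ^ u * b ^ v, ⟨hz, ?_⟩, e, q.den, by lia, hd, ?_, ?_, fun F h1 h2 =>
    mul_mem (zpow_mem h1 _) (zpow_mem h2 _)⟩
  · rw [← Real.log_neg_iff hz]
    have : (0 : ℝ) < q.den := by exact_mod_cast hd
    by_contra hneg
    have := mul_nonneg this.le (not_lt.mp hneg)
    linarith
  · refine Real.log_injOn_pos ha.1 (pow_pos hz _) ?_
    rw [Real.log_pow]
    apply mul_left_cancel₀ hd'
    linear_combination hlog - e * hlz'
  · refine Real.log_injOn_pos hb.1 (pow_pos hz _) ?_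
    rw [Real.log_pow, hlz']

/-- With multiplicatively dependent source weights, all four weights are powers of one number `z`
which generates the common field of the source and the target weights; this leaves the
question which trinomials `X ^ n + X ^ m - 1` share a root in the unit interval. -/
theorem IsShiftBiLipschitz.eq_or_exceptional (hP : ∀ j, P j ∈ Set.Ioo (0 : ℝ) 1)
    (hQ : ∀ j, Q j ∈ Set.Ioo (0 : ℝ) 1) (hPle : P 1 ≤ P 0) (hQle : Q 1 ≤ Q 0)
    (hsum : Q 0 + Q 1 = 1) (hf : IsShiftBiLipschitz P Q f)
    {q : ℚ} (hrat : Real.log (P 0) / Real.log (P 1) = q) :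
    (∀ j, P j = Q j) ∨
      (Real.log (P 0) / Real.log (P 1) = 2 / 3 ∧ Real.log (Q 0) / Real.log (Q 1) = 1 / 5) ∨
      (Real.log (P 0) / Real.log (P 1) = 1 / 5 ∧ Real.log (Q 0) / Real.log (Q 1) = 2 / 3) := by
  obtain ⟨hPsum, hPF, -⟩ := hf.exists_scaling hP hQ hsum
  obtain ⟨-, hQF, x₁, n₁, c, V, hc, hV, hV0, h⟩ := hf.symm.exists_scaling hQ hP hPsum
  obtain ⟨k₀, b₀, c₀, hk₀, r₀⟩ := exists_log_relation hQ hP hc hV hV0 h 0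
  obtain ⟨k₁, b₁, c₁, hk₁, r₁⟩ := exists_log_relation hQ hP hc hV hV0 h 1
  have hPP : ∀ j, P j ∈ ℚ⟮P 0⟯ := by
    have h0 := mem_adjoin_simple_self ℚ (P 0)
    refine Fin.forall_fin_two.mpr ⟨h0, ?_⟩
    rw [show P 1 = 1 - P 0 by linarith]; exact sub_mem (one_mem _) h0
  have hQQ : ∀ j, Q j ∈ ℚ⟮Q 0⟯ := by
    have h0 := mem_adjoin_simple_self ℚ (Q 0)
    refine Fin.forall_fin_two.mpr ⟨h0, ?_⟩
    rw [show Q 1 = 1 - Q 0 by linarith]; exact sub_mem (one_mem _) h0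
  obtain ⟨x, hx, e₁, e₂, he₁, he₂, hx₁, hx₂, hxF⟩ := exists_common_base (hP 0) (hP 1) hrat
  have hlx := Real.log_neg hx.1 hx.2
  have hlQ : ∀ j, Real.log (Q j) < 0 := fun j => Real.log_neg (hQ j).1 (hQ j).2
  have hl₁ : Real.log (P 0) = e₁ * Real.log x := by rw [hx₁, Real.log_pow]
  have hl₂ : Real.log (P 1) = e₂ * Real.log x := by rw [hx₂, Real.log_pow]
  rw [hl₁, hl₂] at r₀ r₁
  have hk₀' : (k₀ : ℝ) ≠ 0 := by exact_mod_cast hk₀.ne'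
  have hk₁' : (k₁ : ℝ) ≠ 0 := by exact_mod_cast hk₁.ne'
  have g₀ : Real.log (Q 0) = ((b₀ * e₁ + c₀ * e₂ : ℚ) / k₀ : ℚ) * Real.log x := by
    push_cast; field_simp; linear_combination r₀
  have g₁ : Real.log (Q 1) = ((b₁ * e₁ + c₁ * e₂ : ℚ) / k₁ : ℚ) * Real.log x := by
    push_cast; field_simp; linear_combination r₁
  obtain ⟨y, hy, e₃, e₄, he₃, he₄, hy₁, hy₂, hyF⟩ := exists_common_base (hQ 0) (hQ 1)
    (q := ((b₀ * e₁ + c₀ * e₂ : ℚ) / k₀ : ℚ) / ((b₁ * e₁ + c₁ * e₂ : ℚ) / k₁ : ℚ)) (by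
      rw [g₀, g₁, mul_div_mul_right _ _ hlx.ne, ← Rat.cast_div])
  have hl₃ : Real.log (Q 0) = e₃ * Real.log y := by rw [hy₁, Real.log_pow]
  have he₃' : (e₃ : ℝ) ≠ 0 := by exact_mod_cast he₃.ne'
  -- a common base of the bases of the two pairs
  obtain ⟨z, hz, m, n, hm, hn, hzx, hzy, hzF⟩ := exists_common_base hy hx
    (q := ((b₀ * e₁ + c₀ * e₂ : ℚ) / k₀ : ℚ) / e₃) (by
      rw [hl₃] at g₀
      rw [div_eq_iff hlx.ne]
      push_cast at g₀ ⊢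
      field_simp at g₀ ⊢
      linear_combination g₀)
  have p₀ : P 0 = z ^ (n * e₁) := by rw [hx₁, hzy, pow_mul]
  have p₁ : P 1 = z ^ (n * e₂) := by rw [hx₂, hzy, pow_mul]
  have q₀ : Q 0 = z ^ (m * e₃) := by rw [hy₁, hzx, pow_mul]
  have q₁ : Q 1 = z ^ (m * e₄) := by rw [hy₂, hzx, pow_mul]
  have hzP : z ∈ ℚ⟮z ^ (n * e₁)⟯ := by
    rw [← p₀]
    exact hzF _ (hyF _ (hQF 0) (hQF 1)) (hxF _ (hPP 0) (hPP 1))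
  have hzQ : z ∈ ℚ⟮z ^ (m * e₃)⟯ := by
    rw [← q₀]
    exact hzF _ (hyF _ (hQQ 0) (hQQ 1)) (hxF _ (hPF 0) (hPF 1))
  have hlz := (Real.log_neg hz.1 hz.2).ne
  have hratio : ∀ a b : ℕ, Real.log (z ^ a) / Real.log (z ^ b) = a / b := by
    intro a b
    rw [Real.log_pow, Real.log_pow, mul_div_mul_right _ _ hlz]
  rw [p₀, p₁] at hPle hPsum
  rw [q₀, q₁] at hQle hsum
  rw [pow_le_pow_iff_right_of_lt_one₀ hz.1 hz.2] at hPle hQle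
  rcases exponents_eq_or_exceptional hz (mul_pos hn he₁) hPle (mul_pos hm he₃) hQle hPsum hsum
    hzP hzQ with ⟨h1, h2⟩ | ⟨h1, h2, h3, h4⟩ | ⟨h1, h2, h3, h4⟩
  · left
    refine Fin.forall_fin_two.mpr ⟨?_, ?_⟩
    · rw [p₀, q₀, h1]
    · rw [p₁, q₁, h2]
  · right; left
    rw [p₀, p₁, q₀, q₁, hratio, hratio, h1, h2, h3, h4]
    norm_num
  · right; right
    rw [p₀, p₁, q₀, q₁, hratio, hratio, h1, h2, h3, h4]
    norm_num

end

end rigidity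

/-! ### Strict Hölder equivalence of self-similar sets -/

theorem exists_rpow_add_rpow_eq_one {a b : ℝ} (ha : a ∈ Set.Ioo (0 : ℝ) 1)
    (hb : b ∈ Set.Ioo (0 : ℝ) 1) : ∃ s : ℝ, 0 < s ∧ a ^ s + b ^ s = 1 := by
  have ha' := tendsto_rpow_atTop_of_base_lt_one a (by linarith [ha.1]) ha.2
  have hb' := tendsto_rpow_atTop_of_base_lt_one b (by linarith [hb.1]) hb.2
  have hlim := ha'.add hb'
  rw [add_zero] at hlim
  obtain ⟨S, hS, hS0⟩ := ((hlim.eventually_lt_const one_pos).and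
    (Filter.eventually_ge_atTop 0)).exists
  have hcont : Continuous fun s : ℝ => a ^ s + b ^ s :=
    (Real.continuous_const_rpow ha.1.ne').add (Real.continuous_const_rpow hb.1.ne')
  obtain ⟨s, hs, hs1⟩ := intermediate_value_Icc' hS0 hcont.continuousOn
    (show (1 : ℝ) ∈ Set.Icc _ _ from ⟨hS.le, by norm_num⟩)
  refine ⟨s, lt_of_le_of_ne hs.1 fun h => ?_, hs1⟩
  rw [← h] at hs1
  norm_num at hs1

/-- A strict Hölder equivalence becomes, in symbolic terms and after raising the contraction ratios
to suitable powers, a bi-Lipschitz bijection of shift spaces; the exponents can be chosen such that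
the target weights sum to one. -/
theorem StrictHolderEquiv.exists_shiftBiLipschitz {d d' : ℕ} {r t : Fin 2 → ℝ}
    (hr : ∀ j, r j ∈ Set.Ioo (0 : ℝ) 1) (ht : ∀ j, t j ∈ Set.Ioo (0 : ℝ) 1)
    {E : Set (EuclideanSpace ℝ (Fin d))} {F : Set (EuclideanSpace ℝ (Fin d'))}
    (hE : E ∈ SelfSimilarSSC d r) (hF : F ∈ SelfSimilarSSC d' t) (h : StrictHolderEquiv E F) :
    ∃ σ τ : ℝ, 0 < σ ∧ 0 < τ ∧ t 0 ^ τ + t 1 ^ τ = 1 ∧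
      ∃ f, IsShiftBiLipschitz (fun j => r j ^ σ) (fun j => t j ^ τ) f := by
  obtain ⟨φ, hφ, hφK, hφs⟩ := hE
  obtain ⟨ψ, hψ, hψK, hψs⟩ := hF
  obtain ⟨e, C, hC, he⟩ := exists_coding hr hφ hφK hφs
  obtain ⟨e', C', hC', he'⟩ := exists_coding ht hψ hψK hψs
  obtain ⟨g, hg, s, D, hs, hD, hgD⟩ := h
  obtain ⟨τ, hτ, hτ1⟩ := exists_rpow_add_rpow_eq_one (ht 0) (ht 1)
  let G := Equiv.ofBijective g hg
  refine ⟨s * τ, τ, mul_pos hs hτ, hτ, hτ1, (e.symm.trans G).trans e', (C' * D * C ^ s) ^ τ,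
    by positivity, fun x y hxy => ?_⟩
  obtain ⟨p, rfl⟩ := e.surjective x
  obtain ⟨q, rfl⟩ := e.surjective y
  have hpq : p ≠ q := fun h => hxy (h ▸ rfl)
  have h1 := he p q hpq
  have h2 := hgD p q
  have h3 := he' (g p) (g q) (hg.injective.ne hpq)
  simp only [Equiv.trans_apply, Equiv.symm_apply_apply]
  change weight (fun j => t j ^ τ) (e' (g p)) (PiNat.firstDiff (e' (g p)) (e' (g q))) ≤ _ ∧
    _ ≤ _ * weight (fun j => t j ^ τ) (e' (g p)) (PiNat.firstDiff (e' (g p)) (e' (g q)))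
  rw [weight_rpow fun j => (hr j).1, weight_rpow fun j => (ht j).1]
  have hw : 0 < weight r (e p) (PiNat.firstDiff (e p) (e q)) := weight_pos fun j => (hr j).1
  have hw' : 0 < weight t (e' (g p)) (PiNat.firstDiff (e' (g p)) (e' (g q))) :=
    weight_pos fun j => (ht j).1
  set w := weight r (e p) (PiNat.firstDiff (e p) (e q))
  set w' := weight t (e' (g p)) (PiNat.firstDiff (e' (g p)) (e' (g q)))
  have hK : 0 ≤ C' * D * C ^ s := by positivity
  rw [Real.rpow_mul hw.le, ← Real.mul_rpow hK (Real.rpow_nonneg hw.le s),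
    ← Real.mul_rpow hK hw'.le]
  rw [inv_mul_le_iff₀ hC] at h1
  rw [inv_mul_le_iff₀ hD] at h2
  rw [inv_mul_le_iff₀ hC'] at h3
  constructor
  · refine Real.rpow_le_rpow hw'.le ?_ hτ.le
    calc w' ≤ C' * dist (g p) (g q) := h3.1
      _ ≤ C' * (D * dist p q ^ s) := by gcongr; exact h2.2
      _ ≤ C' * (D * (C * w) ^ s) := by gcongr; exact h1.2
      _ = C' * D * C ^ s * w ^ s := by rw [Real.mul_rpow hC.le hw.le]; ring
  · refine Real.rpow_le_rpow (Real.rpow_nonneg hw.le s) ?_ hτ.le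
    calc w ^ s ≤ (C * dist p q) ^ s := by gcongr; exact h1.1
      _ = C ^ s * dist p q ^ s := Real.mul_rpow hC.le dist_nonneg
      _ ≤ C ^ s * (D * dist (g p) (g q)) := by gcongr; exact h2.1
      _ ≤ C ^ s * (D * (C' * w')) := by gcongr; exact h3.2
      _ = C' * D * C ^ s * w' := by ring

theorem strictHolderEquiv_of_log_ratio_eq {d d' m : ℕ} [NeZero m] {r t : Fin m → ℝ}
    (hr : ∀ j, r j ∈ Set.Ioo (0 : ℝ) 1) (ht : ∀ j, t j ∈ Set.Ioo (0 : ℝ) 1)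
    (h : ∀ j, Real.log (r j) * Real.log (t 0) = Real.log (r 0) * Real.log (t j))
    {E : Set (EuclideanSpace ℝ (Fin d))} {F : Set (EuclideanSpace ℝ (Fin d'))}
    (hE : E ∈ SelfSimilarSSC d r) (hF : F ∈ SelfSimilarSSC d' t) : StrictHolderEquiv E F := by
  have hlr := Real.log_neg (hr 0).1 (hr 0).2
  have hlt := Real.log_neg (ht 0).1 (ht 0).2
  refine strictHolderEquiv_of_ratios (div_pos_of_neg_of_neg hlt hlr) hr ht (fun j => ?_) hE hF
  refine Real.log_injOn_pos (ht j).1 (Real.rpow_pos_of_pos (hr j).1 _) ?_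
  rw [Real.log_rpow (hr j).1, div_mul_eq_mul_div, eq_div_iff hlr.ne]
  linear_combination -h j

/-- For the exceptional pair, subdividing the second piece of a set with ratios `(ρ ^ 2, ρ ^ 3)` and
the first piece of a set with ratios `(τ, τ ^ 5)` gives the ratios `(2, 5, 6)` in both cases, on a
logarithmic scale. -/
theorem exists_three_ratios {d : ℕ} {r₁ r₂ : ℝ} (hr₁ : r₁ ∈ Set.Ioo (0 : ℝ) 1)
    (hr₂ : r₂ ∈ Set.Ioo (0 : ℝ) 1) {E : Set (EuclideanSpace ℝ (Fin d))}
    (hE : E ∈ SelfSimilarSSC d ![r₁, r₂])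
    (h : Real.log r₁ / Real.log r₂ = 2 / 3 ∨ Real.log r₁ / Real.log r₂ = 1 / 5) :
    ∃ r : Fin 3 → ℝ, (∀ j, r j ∈ Set.Ioo (0 : ℝ) 1) ∧ E ∈ SelfSimilarSSC d r ∧
      ∀ j, Real.log (r j) * 2 = Real.log (r 0) * ![2, 5, 6] j := by
  have hl₂ := (Real.log_neg hr₂.1 hr₂.2).ne
  have hmul : ∀ {a b : ℝ}, a ∈ Set.Ioo (0 : ℝ) 1 → b ∈ Set.Ioo (0 : ℝ) 1 →
      a * b ∈ Set.Ioo (0 : ℝ) 1 := fun ha hb =>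
    ⟨mul_pos ha.1 hb.1, mul_lt_one_of_nonneg_of_lt_one_left ha.1.le ha.2 hb.2.le⟩
  rcases h with h | h
  · rw [div_eq_iff hl₂] at h
    refine ⟨_, ?_, SelfSimilarSSC.subdivide hr₂.1 hE, ?_⟩
    · simp only [Fin.forall_fin_succ]
      exact ⟨hr₁, hmul hr₂ hr₁, hmul hr₂ hr₂, fun i => i.elim0⟩
    · simp only [Fin.forall_fin_succ]
      refine ⟨by simp, ?_, ?_, fun i => i.elim0⟩
      · simp [Real.log_mul hr₂.1.ne' hr₁.1.ne', h]; ring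
      · simp [Real.log_mul hr₂.1.ne' hr₂.1.ne', h]; ring
  · rw [div_eq_iff hl₂] at h
    have hE' : E ∈ SelfSimilarSSC d ![r₂, r₁] := by
      have := SelfSimilarSSC.comp_equiv hE (Equiv.swap 0 1)
      have hswap : ![r₁, r₂] ∘ Equiv.swap 0 1 = ![r₂, r₁] := by
        ext j; fin_cases j <;> simp
      rwa [hswap] at this
    have hE3 := SelfSimilarSSC.comp_equiv (SelfSimilarSSC.subdivide hr₁.1 hE') (finRotate 3).symm
    have hcomp : (![r₂, r₁ * r₂, r₁ * r₁] ∘ (finRotate 3).symm) = ![r₁ * r₁, r₂, r₁ * r₂] := by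
      rw [Equiv.comp_symm_eq]
      ext j; fin_cases j <;> rfl
    rw [hcomp] at hE3
    refine ⟨_, ?_, hE3, ?_⟩
    · simp only [Fin.forall_fin_succ]
      exact ⟨hmul hr₁ hr₁, hr₂, hmul hr₁ hr₂, fun i => i.elim0⟩
    · simp only [Fin.forall_fin_succ]
      refine ⟨by simp, ?_, ?_, fun i => i.elim0⟩
      · simp [Real.log_mul hr₁.1.ne' hr₁.1.ne', h]; ring
      · simp [Real.log_mul hr₁.1.ne' hr₁.1.ne', Real.log_mul hr₁.1.ne' hr₂.1.ne', h]; ring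

theorem strictHolderEquiv_of_exceptional {d d' : ℕ} {r₁ r₂ t₁ t₂ : ℝ}
    (hr₁ : r₁ ∈ Set.Ioo (0 : ℝ) 1) (hr₂ : r₂ ∈ Set.Ioo (0 : ℝ) 1)
    (ht₁ : t₁ ∈ Set.Ioo (0 : ℝ) 1) (ht₂ : t₂ ∈ Set.Ioo (0 : ℝ) 1)
    {E : Set (EuclideanSpace ℝ (Fin d))} {F : Set (EuclideanSpace ℝ (Fin d'))}
    (hE : E ∈ SelfSimilarSSC d ![r₁, r₂]) (hF : F ∈ SelfSimilarSSC d' ![t₁, t₂])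
    (h : Real.log r₁ / Real.log r₂ = 2 / 3 ∨ Real.log r₁ / Real.log r₂ = 1 / 5)
    (h' : Real.log t₁ / Real.log t₂ = 2 / 3 ∨ Real.log t₁ / Real.log t₂ = 1 / 5) :
    StrictHolderEquiv E F := by
  obtain ⟨r, hr, hEr, hlr⟩ := exists_three_ratios hr₁ hr₂ hE h
  obtain ⟨t, ht, hFt, hlt⟩ := exists_three_ratios ht₁ ht₂ hF h'
  refine strictHolderEquiv_of_log_ratio_eq hr ht (fun j => ?_) hEr hFt
  linear_combination (Real.log (t 0) / 2) * hlr j - (Real.log (r 0) / 2) * hlt j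

theorem theorem1p3 (d d' : ℕ) (r₁ r₂ t₁ t₂ : ℝ)
    (hr₁ : r₁ ∈ Set.Ioo (0 : ℝ) 1) (hr₂ : r₂ ∈ Set.Ioo (0 : ℝ) 1)
    (ht₁ : t₁ ∈ Set.Ioo (0 : ℝ) 1) (ht₂ : t₂ ∈ Set.Ioo (0 : ℝ) 1)
    (hr : r₂ ≤ r₁) (ht : t₂ ≤ t₁)
    (E : Set (EuclideanSpace ℝ (Fin d))) (F : Set (EuclideanSpace ℝ (Fin d')))
    (hE : E ∈ SelfSimilarSSC d ![r₁, r₂]) (hF : F ∈ SelfSimilarSSC d' ![t₁, t₂]) :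
    (Irrational (Real.log r₁ / Real.log r₂) →
      (StrictHolderEquiv E F ↔
        Real.log r₁ / Real.log t₁ = Real.log r₂ / Real.log t₂)) ∧
    ((∃ q : ℚ, Real.log r₁ / Real.log r₂ = (q : ℝ)) →
      (StrictHolderEquiv E F ↔
        (Real.log r₁ / Real.log t₁ = Real.log r₂ / Real.log t₂ ∨
          (Real.log r₁ / Real.log r₂ = 2 / 3 ∧ Real.log t₁ / Real.log t₂ = 1 / 5) ∨
          (Real.log r₁ / Real.log r₂ = 1 / 5 ∧ Real.log t₁ / Real.log t₂ = 2 / 3)))) := by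
  have hR : ∀ j, ![r₁, r₂] j ∈ Set.Ioo (0 : ℝ) 1 := Fin.forall_fin_two.mpr ⟨hr₁, hr₂⟩
  have hT : ∀ j, ![t₁, t₂] j ∈ Set.Ioo (0 : ℝ) 1 := Fin.forall_fin_two.mpr ⟨ht₁, ht₂⟩
  have hl₁ := (Real.log_neg ht₁.1 ht₁.2).ne
  have hl₂ := (Real.log_neg ht₂.1 ht₂.2).ne
  have hsuff : Real.log r₁ / Real.log t₁ = Real.log r₂ / Real.log t₂ → StrictHolderEquiv E F := by
    intro h
    rw [div_eq_div_iff hl₁ hl₂] at h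
    exact strictHolderEquiv_of_log_ratio_eq hR hT
      (Fin.forall_fin_two.mpr ⟨rfl, by simpa using h.symm⟩) hE hF
  have hnec : StrictHolderEquiv E F → ∃ P Q : Fin 2 → ℝ, (∀ j, P j ∈ Set.Ioo (0 : ℝ) 1) ∧
      (∀ j, Q j ∈ Set.Ioo (0 : ℝ) 1) ∧ P 1 ≤ P 0 ∧ Q 1 ≤ Q 0 ∧ Q 0 + Q 1 = 1 ∧
      (∃ f, IsShiftBiLipschitz P Q f) ∧
      Real.log (P 0) / Real.log (P 1) = Real.log r₁ / Real.log r₂ ∧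
      Real.log (Q 0) / Real.log (Q 1) = Real.log t₁ / Real.log t₂ ∧
      ((∀ j, P j = Q j) → Real.log r₁ / Real.log t₁ = Real.log r₂ / Real.log t₂) := by
    intro h
    obtain ⟨σ, τ, hσ, hτ, hsum, hf⟩ := h.exists_shiftBiLipschitz hR hT hE hF
    have hpow : ∀ {a s : ℝ}, a ∈ Set.Ioo (0 : ℝ) 1 → 0 < s → a ^ s ∈ Set.Ioo (0 : ℝ) 1 :=
      fun ha hs => ⟨Real.rpow_pos_of_pos ha.1 _, Real.rpow_lt_one ha.1.le ha.2 hs⟩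
    refine ⟨_, _, fun j => hpow (hR j) hσ, fun j => hpow (hT j) hτ,
      Real.rpow_le_rpow hr₂.1.le hr hσ.le, Real.rpow_le_rpow ht₂.1.le ht hτ.le, hsum, hf,
      ?_, ?_, fun hPQ => ?_⟩
    · change Real.log (r₁ ^ σ) / Real.log (r₂ ^ σ) = _
      rw [Real.log_rpow hr₁.1, Real.log_rpow hr₂.1, mul_div_mul_left _ _ hσ.ne']
    · change Real.log (t₁ ^ τ) / Real.log (t₂ ^ τ) = _
      rw [Real.log_rpow ht₁.1, Real.log_rpow ht₂.1, mul_div_mul_left _ _ hτ.ne']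
    · have h0 : Real.log (r₁ ^ σ) = Real.log (t₁ ^ τ) := congrArg Real.log (hPQ 0)
      have h1 : Real.log (r₂ ^ σ) = Real.log (t₂ ^ τ) := congrArg Real.log (hPQ 1)
      rw [Real.log_rpow hr₁.1, Real.log_rpow ht₁.1] at h0
      rw [Real.log_rpow hr₂.1, Real.log_rpow ht₂.1] at h1
      rw [div_eq_div_iff hl₁ hl₂]
      apply mul_left_cancel₀ hσ.ne'
      linear_combination Real.log t₂ * h0 - Real.log t₁ * h1
  refine ⟨fun hirr => ⟨fun h => ?_, hsuff⟩, fun ⟨q, hq⟩ => ⟨fun h => ?_, ?_⟩⟩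
  · obtain ⟨P, Q, hP, hQ, hPle, hQle, hsum, ⟨f, hf⟩, hlP, -, hfin⟩ := hnec h
    exact hfin (hf.eq_of_irrational hP hQ hPle hQle hsum (hlP ▸ hirr))
  · obtain ⟨P, Q, hP, hQ, hPle, hQle, hsum, ⟨f, hf⟩, hlP, hlQ, hfin⟩ := hnec h
    have := hf.eq_or_exceptional hP hQ hPle hQle hsum (hlP.trans hq)
    rw [hlP, hlQ] at this
    exact this.imp_left hfin
  · rintro (h | ⟨h, h'⟩ | ⟨h, h'⟩)
    · exact hsuff h
    · exact strictHolderEquiv_of_exceptional hr₁ hr₂ ht₁ ht₂ hE hF (Or.inl h) (Or.inr h')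
    · exact strictHolderEquiv_of_exceptional hr₁ hr₂ ht₁ ht₂ hE hF (Or.inr h) (Or.inl h')
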